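/- **Language.** Types are base types $\mathsf B$ (Booleans and arbitrary further ones with a linear order), trees $\mathsf T$ (binary, inner nodes labelled by elements of a base type, label-free leaves) and products. Values are base elements, trees and pairs. $|t|$ is the number of leaves of a tree $t$. Expressions are, for variables $x,y,x_i$ and function symbols $f$: variables, constants, $\mathsf{leaf}$, $\mathsf{node}\,x_1\,x_2\,x_3$, $(x_1,x_2)$, comparisons $x_1\circ x_2$, calls $f\,x_1\dots x_n$, ticks $\checkmark^{r}e$ (with $r\in\mathbb Q_{\ge0}$), $\mathsf{if}\ x$, $\mathsf{if\ nondet}$ and $\mathsf{if\ coin}\ p$ (with $p\in\mathbb Q\cap[0,1]$) conditionals, $\mathsf{match}$ on trees and on pairs, and $\mathsf{let}\ x=e_1\ \mathsf{in}\ e_2$. A program $\mathsf P$ gives every $f$ one definition $f\,x_1\dots x_n=e_f$. **Semantics.** Closed instances of expressions are reduced by the usual call-by-value rules, in the evaluation contexts $C::=\Box\mid\mathsf{let}\ x=C\ \mathsf{in}\ e$; $\checkmark^{r}e\to e$ costs $r$, all other steps cost $0$; $\mathsf{if\ coin}\ p$ reduces to the multidistribution $\{e_1^{p},e_2^{1-p}\}$;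 $\mathsf{if\ nondet}$ reduces to either branch. A multidistribution (a multiset of weighted expressions) makes a step by reducing every member that is not in normal form, independently of the others, and keeping the normal forms; the cost of the step is the expected cost. An evaluation of $e$ is an infinite sequence $\{e^1\}\to^{c_1}\mu_1\to^{c_2}\mu_2\to\cdots$; its expected cost is $\sum_n c_n\in[0,\infty]$, its expected length is the sum over $n\ge 0$ of the probability that $\mu_n$ (with $\mu_0=\{e^1\}$) gives to reducible expressions, and its result is the subdistribution $\lim_n\overline{\mu_n}$ restricted to values. An expression $e$ in context $\Gamma$ is *positively almost surely terminating* if for every substitution $\sigma$ of values that respects $\Gamma$, every evaluation of $e\sigma$ has finite expected cost and finite expected length. It is *almost surely terminating* if for every such $\sigma$ the result of every evaluation of $e\sigma$ is a full distribution (total mass $1$) over values. *Ticking accounts for all evaluation steps of $\mathsf P$* if in all bodies $e_f$ every subexpression other than a tick, a variable, a constant, $\mathsf{leaf}$, $\mathsf{node}\,x_1x_2x_3$ or $(x_1,x_2)$ stands directly below a tick, and all ticks cost at least $1$. **Annotations.** An annotation $Q$ for trees $t_1,\dots,t_m$ consists of non-negative coefficients $q_i$ and $q_{(\vec a,b)}$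 ($\vec a\in\mathbb N^m$, $b\in\mathbb Z$, $\sum a_i+b\ge 1$), almost all zero; its potential is $\Phi(\vec t\,|\,Q)=\sum_i q_i\,\mathrm{rk}(t_i)+\sum q_{(\vec a,b)}\log_2(\sum_i a_i|t_i|+b)$, where $\mathrm{rk}(\mathsf{leaf})=1$ and $\mathrm{rk}(\mathsf{node}\,l\,d\,r)=\mathrm{rk}(l)+\log_2|l|+\log_2|r|+\mathrm{rk}(r)$. $Q+K$ adds $K$ to $q_{(\vec 0,2)}$. Variables and results carry potential if their type contains exactly one tree, namely through that tree; we write $\alpha\ni\mathsf T$ for such types, and $q'_*,q'_{(d,e)}$ for the coefficients of a result. Annotated signatures $\mathcal F,\mathcal F^{\mathrm{cf}},\mathcal F^{\mathrm{nd}}$ give every $f$ sets of types $\alpha_1\times\dots\times\alpha_n|Q\to\beta|Q'$. **Typing.** $\Gamma|Q\vdash e:\alpha|Q'$ is generated by the following rules (coefficients not mentioned are $0$; contexts joined by a comma are disjoint). - $x:\alpha|Q\vdash x:\alpha|Q$. Constants (empty context) and comparisons of two variables of the same base type have $Q'=Q$ with constant coefficients only. $\varepsilon|Q+q'_*\vdash\mathsf{leaf}:\mathsf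 T|Q'$ if $q_{(c)}=\sum_{a+b=c}q'_{(a,b)}$. For $\mathsf{node}\,x_1x_2x_3$ (with $x_1,x_3:\mathsf T$, $x_2:\mathsf B$): $q_1=q_2=q_{(1,0,0)}=q_{(0,1,0)}=q'_*$, $q_{(a,a,c)}=q'_{(a,c)}$. For $(x_1,x_2)$ with at most one tree in $\alpha_1\times\alpha_2$: $Q=Q'$. - $\Gamma,x:\mathsf{Bool}|Q\vdash\mathsf{if}\ x\dots$ and $\Gamma|Q\vdash\mathsf{if\ nondet}\dots$ if both branches have $\Gamma|Q\vdash e_i:\alpha|Q'$; $\Gamma|pQ_1+(1-p)Q_2\vdash\mathsf{if\ coin}\ p\dots$ if $\Gamma|Q_i\vdash e_i:\alpha|Q'$; $\Gamma|Q+r\vdash\checkmark^{r}e:\alpha|Q'$ if $\Gamma|Q\vdash e:\alpha|Q'$. - $\Gamma,x:\mathsf T|Q\vdash\mathsf{match}\ x\ \mathsf{with}\ \mathsf{leaf}\to e_1\mid\mathsf{node}\,x_1x_2x_3\to e_2$ if $\Gamma|P+q_{m+1}\vdash e_1$ and $\Gamma,x_1:\mathsf T,x_2:\mathsf B,x_3:\mathsf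 T|R\vdash e_2$ (same result), where $p_i=r_i=q_i$, $p_{(\vec a,c)}=\sum_{a+b=c}q_{(\vec a,a,b)}$, $r_{(\vec a,a,a,b)}=q_{(\vec a,a,b)}$, $r_{m+1}=r_{m+2}=r_{(\vec0,1,0,0)}=r_{(\vec0,0,1,0)}=q_{m+1}$. For pairs with at most one tree, the components take over the annotation. - $\Gamma,\Delta|Q\vdash\mathsf{let}\ x=e_1\ \mathsf{in}\ e_2:\beta|Q'$ if $\Gamma|P\vdash e_1:\alpha|P'$ and $\Delta,x:\alpha|R\vdash e_2:\beta|Q'$, where $p_i=q_i$, $p_{(\vec a,c)}=q_{(\vec a,\vec0,c)}$, $r_j=q_{m+j}$, $r_{(\vec b,c)}$ (resp. $r_{(\vec b,0,c)}$) $=q_{(\vec0,\vec b,c)}$ for $\vec b\ne\vec0$, and: if not $\alpha\ni\mathsf T$, then $r_{(\vec0,c)}=p'_{(c)}$; if $\alpha\ni\mathsf T$, then $r_x=p'_*$, $r_{(\vec0,d,e)}=p'_{(d,e)}$, and there is a finite set $I$ of triples $k=(\vec b,d,e)$ with $\vec b\neq\vec 0$, $d\ne0$, $\sum b_j+d+e\ge1$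 and $\sum_j b_j+e\ge0$ such that $r_{(\vec b,d,e)}=0$ for all other $(\vec b,d,e)$ with $\vec b\ne\vec0,d\ne0$, and for every $k\in I$ there is $P^{k}$ with coefficients $p^{k}_{(\vec a,c)}$, $\vec a\ne\vec0$, only, with $\Gamma|P^{k}\vdash^{\mathrm{nd}}e_1:\alpha|P'^{k}$, the only non-zero coefficient of $P'^k$ being $p'^{k}_{(d,\max\{e,0\})}=r_{(\vec b,d,e)}$, with $\sum_{(\vec a,c)}p^{k}_{(\vec a,c)}\ge r_{(\vec b,d,e)}$, with $p^{k}_{(\vec a,c)}\ge r_{(\vec b,d,e)}$ whenever $p^{k}_{(\vec a,c)}\ne0$, and with $q_{(\vec a,\vec b,c)}=\sum_{(d,e)}p^{(\vec b,d,e)}_{(\vec a,c+\max\{-e,0\})}$ for $\vec a,\vec b\ne\vec0$. - $x_1:\alpha_1,\dots,x_n:\alpha_n|P+K\cdot Q\vdash f\,x_1\dots x_n:\beta|P'+K\cdot Q'$ for $K\ge0$, if $\vec\alpha|P\to\beta|P'\in\mathcal F(f)$ and $\vec\alpha|Q\to\beta|Q'\in\mathcal F^{\mathrm{cf}}(f)$.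 - Structural rules: an unused variable may be added, with arbitrary further coefficients; two variables $x,y$ of the same type may be identified (the coefficients with $a_x+a_y=a$ are added); $\Gamma|Q\vdash e:\alpha|Q'$ follows from $\Gamma|P\vdash e:\alpha|P'$ if $\Phi(\Gamma|P)\le\Phi(\Gamma|Q)$ and $\Phi(P')\ge\Phi(Q')$ for all values, and $\Gamma|Q+K\vdash e:\alpha|Q'+K$ ($K\ge0$) from $\Gamma|Q\vdash e:\alpha|Q'$. The cost-free judgement $\vdash^{\mathrm{cf}}$ has the same rules with ticks ignored and $\mathcal F^{\mathrm{cf}}$ for $\mathcal F$; the non-deterministic cost-free judgement $\vdash^{\mathrm{nd}}$ in addition types $\mathsf{coin}$ like $\mathsf{nondet}$ and uses $\mathcal F^{\mathrm{nd}}$ throughout. $\mathsf P$ is *well-typed* if every body $e_f$ has all types listed for $f$ in $\mathcal F$, $\mathcal F^{\mathrm{cf}}$, $\mathcal F^{\mathrm{nd}}$, in the respective judgement. **Theorem.** Let $\mathsf P$ be a well-typed program such that ticking accounts for all evaluation steps of $\mathsf P$, and suppose $\Gamma|Q\vdash e:\alpha|Q'$. Then $e$ is positively almost surely terminating, and in particular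 almost surely terminating. -/

import Mathlib

open scoped NNReal ENNReal NNRat

noncomputable section

/-! ### Types and values -/

/-- Program variables. -/
abbrev Var : Type := ℕ

/-- An arbitrary collection of base types besides the Booleans (integers, rationals, ...): every
name `i : ι` stands for a set of elements, which can be compared. -/
class BaseTypes (ι : Type) where
  Elem : ι → Type
  order : ∀ i, LinearOrder (Elem i)

/-- The base types: Booleans and the given ones. -/
inductive Base (ι : Type) : Type
  | bool
  | other (i : ι)

/-- The elements of a base type. -/
def Base.Elem {ι : Type} [BaseTypes ι] : Base ι → Type
  | .bool => Bool
  | .other i => BaseTypes.Elem i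

instance Base.instOrder {ι : Type} [BaseTypes ι] : (b : Base ι) → LinearOrder b.Elem
  | .bool => inferInstanceAs (LinearOrder Bool)
  | .other i => BaseTypes.order i

/-- Types: base types, binary trees with labels in a base type, and products. -/
inductive Ty (ι : Type) : Type
  | base (b : Base ι)
  | tree (b : Base ι)
  | prod (α β : Ty ι)

/-- The type of Booleans. -/
abbrev Ty.bool {ι : Type} : Ty ι := .base .bool

/-- Number of occurrences of tree types in a type. Only the types with exactly one occurrence
carry potential, namely that of the unique tree contained in their values. -/
def Ty.numTrees {ι : Type} : Ty ι → ℕ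
  | .base _ => 0
  | .tree _ => 1
  | .prod α β => α.numTrees + β.numTrees

/-- Values: elements of base types, trees and pairs of values. -/
inductive Val (ι : Type) [BaseTypes ι] : Type
  | const (b : Base ι) (x : b.Elem)
  | leaf
  | node (l d r : Val ι)
  | pair (v w : Val ι)

/-- Typing of values. -/
inductive Val.HasType {ι : Type} [BaseTypes ι] : Val ι → Ty ι → Prop
  | const (b : Base ι) (x : b.Elem) : Val.HasType (.const b x) (.base b)
  | leaf (b : Base ι) : Val.HasType .leaf (.tree b)
  | node {b : Base ι} {l d r : Val ι} : Val.HasType l (.tree b) → Val.HasType d (.base b) →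
      Val.HasType r (.tree b) → Val.HasType (.node l d r) (.tree b)
  | pair {α β : Ty ι} {v w : Val ι} : Val.HasType v α → Val.HasType w β →
      Val.HasType (.pair v w) (.prod α β)

/-- The size (number of leaves) of a tree; for a pair with exactly one tree component, the size
of that component. -/
def Val.size {ι : Type} [BaseTypes ι] : Val ι → ℕ
  | .const _ _ => 0
  | .leaf => 1
  | .node l _ r => l.size + r.size
  | .pair v w => v.size + w.size

/-- The rank of a tree (logarithms are to base 2); for a pair with exactly one tree component,
the rank of that component. -/
def Val.rank {ι : Type} [BaseTypes ι] : Val ι → ℝ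
  | .const _ _ => 0
  | .leaf => 1
  | .node l _ r => l.rank + Real.logb 2 l.size + Real.logb 2 r.size + r.rank
  | .pair v w => v.rank + w.rank

/-! ### Expressions and programs -/

/-- Operands: variables, or values which have been substituted for variables. -/
inductive Opd (ι : Type) [BaseTypes ι] : Type
  | var (x : Var)
  | val (v : Val ι)

/-- Comparison operators. -/
inductive Cmp : Type
  | lt
  | gt
  | eq

/-- The truth value of a comparison. -/
def Cmp.eval {A : Type} [LinearOrder A] : Cmp → A → A → Bool
  | .lt, x, y => decide (x < y)
  | .gt, x, y => decide (y < x)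
  | .eq, x, y => decide (x = y)

/-- Expressions in let-normal form, over a set `F` of function symbols. The rational literals
`a/b` of ticks and coins are non-negative, those of coins are at most one. -/
inductive Expr (ι : Type) [BaseTypes ι] (F : Type) : Type
  /-- a variable or a value -/
  | ret (o : Opd ι)
  /-- a constant of a base type, such as `true` and `false` -/
  | const (b : Base ι) (x : b.Elem)
  | leaf
  | node (l d r : Opd ι)
  | pair (o₁ o₂ : Opd ι)
  | cmp (op : Cmp) (o₁ o₂ : Opd ι)
  /-- function application -/
  | app (f : F) (args : List (Opd ι))
  /-- ticking with cost `c` -/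
  | tick (c : ℚ≥0) (e : Expr ι F)
  | ite (o : Opd ι) (e₁ e₂ : Expr ι F)
  /-- non-deterministic choice -/
  | nondet (e₁ e₂ : Expr ι F)
  /-- a coin toss, with probability `p` for the first branch -/
  | coin (p : ℚ≥0) (hp : p ≤ 1) (e₁ e₂ : Expr ι F)
  /-- `match o with | leaf -> e₁ | node y₁ y₂ y₃ -> e₂` -/
  | matchTree (o : Opd ι) (e₁ : Expr ι F) (y₁ y₂ y₃ : Var) (e₂ : Expr ι F)
  /-- `match o with | (y₁, y₂) -> e` -/
  | matchPair (o : Opd ι) (y₁ y₂ : Var) (e : Expr ι F)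
  /-- `let x = e₁ in e₂` -/
  | letIn (x : Var) (e₁ e₂ : Expr ι F)

/-- A program: for every function symbol `f` a definition `f x₁ ... xₙ = e`. -/
structure Program (ι : Type) [BaseTypes ι] (F : Type) where
  params : F → List Var
  nodup : ∀ f, (params f).Nodup
  body : F → Expr ι F

section Operations

variable {ι : Type} [BaseTypes ι] {F : Type}

/-- Substitution of values in an operand. -/
def Opd.subst (σ : Var → Option (Val ι)) : Opd ι → Opd ι
  | .var x => (σ x).elim (.var x) .val
  | .val v => .val v

/-- Parallel substitution of (closed) values for free variables. -/
def Expr.subst (σ : Var → Option (Val ι)) : Expr ι F → Expr ι F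
  | .ret o => .ret (o.subst σ)
  | .const b x => .const b x
  | .leaf => .leaf
  | .node l d r => .node (l.subst σ) (d.subst σ) (r.subst σ)
  | .pair o₁ o₂ => .pair (o₁.subst σ) (o₂.subst σ)
  | .cmp op o₁ o₂ => .cmp op (o₁.subst σ) (o₂.subst σ)
  | .app f args => .app f (args.map (Opd.subst σ))
  | .tick c e => .tick c (e.subst σ)
  | .ite o e₁ e₂ => .ite (o.subst σ) (e₁.subst σ) (e₂.subst σ)
  | .nondet e₁ e₂ => .nondet (e₁.subst σ) (e₂.subst σ)
  | .coin p hp e₁ e₂ => .coin p hp (e₁.subst σ) (e₂.subst σ)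
  | .matchTree o e₁ y₁ y₂ y₃ e₂ => .matchTree (o.subst σ) (e₁.subst σ) y₁ y₂ y₃
      (e₂.subst (fun v => if v = y₁ ∨ v = y₂ ∨ v = y₃ then none else σ v))
  | .matchPair o y₁ y₂ e => .matchPair (o.subst σ) y₁ y₂
      (e.subst (fun v => if v = y₁ ∨ v = y₂ then none else σ v))
  | .letIn x e₁ e₂ => .letIn x (e₁.subst σ)
      (e₂.subst (fun v => if v = x then none else σ v))

/-- The substitution `{x₁ ↦ v₁, ..., xₙ ↦ vₙ}`. -/
def bindings (xs : List Var) (vs : List (Val ι)) : Var → Option (Val ι) :=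
  fun x => (xs.zip vs).lookup x

/-- The instance `eσ` under a substitution of values for all variables. -/
def Expr.inst (σ : Var → Val ι) (e : Expr ι F) : Expr ι F := e.subst (fun x => some (σ x))

/-- Variables occurring in an operand. -/
def Opd.fv : Opd ι → Set Var
  | .var x => {x}
  | .val _ => ∅

/-- Free variables. -/
def Expr.fv : Expr ι F → Set Var
  | .ret o => o.fv
  | .const _ _ => ∅
  | .leaf => ∅
  | .node l d r => l.fv ∪ d.fv ∪ r.fv
  | .pair o₁ o₂ => o₁.fv ∪ o₂.fv
  | .cmp _ o₁ o₂ => o₁.fv ∪ o₂.fv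
  | .app _ args => {x | ∃ o ∈ args, x ∈ o.fv}
  | .tick _ e => e.fv
  | .ite o e₁ e₂ => o.fv ∪ e₁.fv ∪ e₂.fv
  | .nondet e₁ e₂ => e₁.fv ∪ e₂.fv
  | .coin _ _ e₁ e₂ => e₁.fv ∪ e₂.fv
  | .matchTree o e₁ y₁ y₂ y₃ e₂ => o.fv ∪ e₁.fv ∪ (e₂.fv \ {y₁, y₂, y₃})
  | .matchPair o y₁ y₂ e => o.fv ∪ (e.fv \ {y₁, y₂})
  | .letIn x e₁ e₂ => e₁.fv ∪ (e₂.fv \ {x})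

/-- Renaming of variables in an operand. -/
def Opd.rename (ρ : Var → Var) : Opd ι → Opd ι
  | .var x => .var (ρ x)
  | .val v => .val v

/-- Renaming of free variables. -/
def Expr.rename (ρ : Var → Var) : Expr ι F → Expr ι F
  | .ret o => .ret (o.rename ρ)
  | .const b x => .const b x
  | .leaf => .leaf
  | .node l d r => .node (l.rename ρ) (d.rename ρ) (r.rename ρ)
  | .pair o₁ o₂ => .pair (o₁.rename ρ) (o₂.rename ρ)
  | .cmp op o₁ o₂ => .cmp op (o₁.rename ρ) (o₂.rename ρ)
  | .app f args => .app f (args.map (Opd.rename ρ))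
  | .tick c e => .tick c (e.rename ρ)
  | .ite o e₁ e₂ => .ite (o.rename ρ) (e₁.rename ρ) (e₂.rename ρ)
  | .nondet e₁ e₂ => .nondet (e₁.rename ρ) (e₂.rename ρ)
  | .coin p hp e₁ e₂ => .coin p hp (e₁.rename ρ) (e₂.rename ρ)
  | .matchTree o e₁ y₁ y₂ y₃ e₂ => .matchTree (o.rename ρ) (e₁.rename ρ) y₁ y₂ y₃
      (e₂.rename (fun v => if v = y₁ ∨ v = y₂ ∨ v = y₃ then v else ρ v))
  | .matchPair o y₁ y₂ e => .matchPair (o.rename ρ) y₁ y₂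
      (e.rename (fun v => if v = y₁ ∨ v = y₂ then v else ρ v))
  | .letIn x e₁ e₂ => .letIn x (e₁.rename ρ)
      (e₂.rename (fun v => if v = x then v else ρ v))

/-- No binder of the expression captures a renamed variable. -/
def Expr.NoCapture (ρ : Var → Var) : Expr ι F → Prop
  | .tick _ e => e.NoCapture ρ
  | .ite _ e₁ e₂ => e₁.NoCapture ρ ∧ e₂.NoCapture ρ
  | .nondet e₁ e₂ => e₁.NoCapture ρ ∧ e₂.NoCapture ρ
  | .coin _ _ e₁ e₂ => e₁.NoCapture ρ ∧ e₂.NoCapture ρ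
  | .matchTree _ e₁ y₁ y₂ y₃ e₂ => e₁.NoCapture ρ ∧
      (∀ v ∈ e₂.fv \ {y₁, y₂, y₃}, ρ v ∉ ({y₁, y₂, y₃} : Set Var)) ∧
      e₂.NoCapture (fun v => if v = y₁ ∨ v = y₂ ∨ v = y₃ then v else ρ v)
  | .matchPair _ y₁ y₂ e =>
      (∀ v ∈ e.fv \ {y₁, y₂}, ρ v ∉ ({y₁, y₂} : Set Var)) ∧
      e.NoCapture (fun v => if v = y₁ ∨ v = y₂ then v else ρ v)
  | .letIn x e₁ e₂ => e₁.NoCapture ρ ∧ (∀ v ∈ e₂.fv \ {x}, ρ v ≠ x) ∧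
      e₂.NoCapture (fun v => if v = x then v else ρ v)
  | _ => True

/-- The value of an operand, if it is one. -/
def Opd.toVal : Opd ι → Option (Val ι)
  | .var _ => none
  | .val v => some v

/-- The value that an expression is, if it is one. -/
def Expr.toVal : Expr ι F → Option (Val ι)
  | .ret o => o.toVal
  | .const b x => some (.const b x)
  | .leaf => some .leaf
  | .node (.val l) (.val d) (.val r) => some (.node l d r)
  | .pair (.val v) (.val w) => some (.pair v w)
  | _ => none

/-- Every statement is enclosed in a tick of cost at least one. The flag records whether the
expression stands directly below a tick. Values and variables need no evaluation step. -/
def Expr.Ticked : Expr ι F → Bool → Prop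
  | .ret _, _ => True
  | .const _ _, _ => True
  | .leaf, _ => True
  | .node _ _ _, _ => True
  | .pair _ _, _ => True
  | .tick c e, _ => 1 ≤ c ∧ e.Ticked true
  | .cmp _ _ _, t => t = true
  | .app _ _, t => t = true
  | .ite _ e₁ e₂, t => t = true ∧ e₁.Ticked false ∧ e₂.Ticked false
  | .nondet e₁ e₂, t => t = true ∧ e₁.Ticked false ∧ e₂.Ticked false
  | .coin _ _ e₁ e₂, t => t = true ∧ e₁.Ticked false ∧ e₂.Ticked false
  | .matchTree _ e₁ _ _ _ e₂, t => t = true ∧ e₁.Ticked false ∧ e₂.Ticked false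
  | .matchPair _ _ _ e, t => t = true ∧ e.Ticked false
  | .letIn _ e₁ e₂, t => t = true ∧ e₁.Ticked false ∧ e₂.Ticked false

/-- Ticking accounts for all evaluation steps of the program. -/
def Program.Ticked (P : Program ι F) : Prop := ∀ f, (P.body f).Ticked false

/-! ### Small-step semantics -/

/-- Multidistributions: multisets of weighted objects. Reducts are finitely branching, so finite
multisets suffice for evaluations. -/
abbrev MDist (A : Type) : Type := Multiset (ℝ≥0 × A)

/-- `p · μ` -/
def MDist.scale {A : Type} (p : ℝ≥0) (μ : MDist A) : MDist A := μ.map fun a => (p * a.1, a.2)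

/-- Image of a multidistribution. -/
def MDist.mapObj {A B : Type} (g : A → B) (μ : MDist A) : MDist B := μ.map fun a => (a.1, g a.2)

/-- Weighted probabilistic one-step reduction, closed under the evaluation contexts
`C ::= □ | let x = C in e`. -/
inductive Step (P : Program ι F) : Expr ι F → ℝ≥0 → MDist (Expr ι F) → Prop
  | letVal (x : Var) (w e₂ : Expr ι F) (v : Val ι) : w.toVal = some v →
      Step P (.letIn x w e₂) 0 {(1, e₂.subst (bindings [x] [v]))}
  | letCtx (x : Var) (e₁ e₂ : Expr ι F) (c : ℝ≥0) (μ : MDist (Expr ι F)) : Step P e₁ c μ →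
      Step P (.letIn x e₁ e₂) c (μ.mapObj fun e => .letIn x e e₂)
  | iteTrue (e₁ e₂ : Expr ι F) :
      Step P (.ite (.val (.const .bool true)) e₁ e₂) 0 {(1, e₁)}
  | iteFalse (e₁ e₂ : Expr ι F) :
      Step P (.ite (.val (.const .bool false)) e₁ e₂) 0 {(1, e₂)}
  | coin (p : ℚ≥0) (hp : p ≤ 1) (e₁ e₂ : Expr ι F) :
      Step P (.coin p hp e₁ e₂) 0 {((p : ℝ≥0), e₁), (1 - (p : ℝ≥0), e₂)}
  | nondetLeft (e₁ e₂ : Expr ι F) : Step P (.nondet e₁ e₂) 0 {(1, e₁)}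
  | nondetRight (e₁ e₂ : Expr ι F) : Step P (.nondet e₁ e₂) 0 {(1, e₂)}
  | cmp (op : Cmp) (b : Base ι) (x y : b.Elem) :
      Step P (.cmp op (.val (.const b x)) (.val (.const b y))) 0
        {(1, .const .bool (op.eval x y))}
  | matchLeaf (e₁ : Expr ι F) (y₁ y₂ y₃ : Var) (e₂ : Expr ι F) :
      Step P (.matchTree (.val .leaf) e₁ y₁ y₂ y₃ e₂) 0 {(1, e₁)}
  | matchNode (l d r : Val ι) (e₁ : Expr ι F) (y₁ y₂ y₃ : Var) (e₂ : Expr ι F) :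
      Step P (.matchTree (.val (.node l d r)) e₁ y₁ y₂ y₃ e₂) 0
        {(1, e₂.subst (bindings [y₁, y₂, y₃] [l, d, r]))}
  | matchPair (v w : Val ι) (y₁ y₂ : Var) (e : Expr ι F) :
      Step P (.matchPair (.val (.pair v w)) y₁ y₂ e) 0
        {(1, e.subst (bindings [y₁, y₂] [v, w]))}
  | app (f : F) (vs : List (Val ι)) : vs.length = (P.params f).length →
      Step P (.app f (vs.map Opd.val)) 0 {(1, (P.body f).subst (bindings (P.params f) vs))}
  | tick (c : ℚ≥0) (e : Expr ι F) : Step P (.tick c e) (c : ℝ≥0) {(1, e)}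

/-- Normal forms. -/
def Terminal (P : Program ι F) (e : Expr ι F) : Prop := ∀ c μ, ¬ Step P e c μ

/-- One step of a single object of a multidistribution: a normal form stays as it is. -/
inductive StepNF (P : Program ι F) : Expr ι F → ℝ≥0 → MDist (Expr ι F) → Prop
  | nf (e : Expr ι F) : Terminal P e → StepNF P e 0 {(1, e)}
  | step (e : Expr ι F) (c : ℝ≥0) (μ : MDist (Expr ι F)) : Step P e c μ → StepNF P e c μ

/-- One step of a multidistribution: every member (every copy independently of the others) does
one step; costs are averaged and reducts are joined. -/
inductive MStep (P : Program ι F) : MDist (Expr ι F) → ℝ≥0 → MDist (Expr ι F) → Prop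
  | nil : MStep P 0 0 0
  | cons (p : ℝ≥0) (e : Expr ι F) (c : ℝ≥0) (ν : MDist (Expr ι F))
      (μ : MDist (Expr ι F)) (c' : ℝ≥0) (ν' : MDist (Expr ι F)) :
      StepNF P e c ν → MStep P μ c' ν' →
      MStep P ((p, e) ::ₘ μ) (p * c + c') (ν.scale p + ν')

/-- An evaluation of `e`: an infinite sequence of steps of multidistributions from `{e^1}`.
(Sequences never get stuck, as normal forms are repeated.) -/
structure Evaluation (P : Program ι F) (e : Expr ι F) where
  state : ℕ → MDist (Expr ι F)
  stepCost : ℕ → ℝ≥0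
  init : state 0 = {(1, e)}
  step : ∀ n, MStep P (state n) (stepCost n) (state (n + 1))

open Classical in
/-- The probability of the value `v` in a multidistribution over expressions. -/
def MDist.valueProb (μ : MDist (Expr ι F)) (v : Val ι) : ℝ≥0 :=
  (μ.map fun a => if a.2.toVal = some v then a.1 else 0).sum

open Classical in
/-- The probability that a multidistribution over expressions assigns to reducible ones. -/
def MDist.activeProb (P : Program ι F) (μ : MDist (Expr ι F)) : ℝ≥0 :=
  (μ.map fun a => if Terminal P a.2 then 0 else a.1).sum

/-- The expected cost of an evaluation. -/
def Evaluation.cost {P : Program ι F} {e : Expr ι F} (E : Evaluation P e) : ℝ≥0∞ :=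
  ∑' n, (E.stepCost n : ℝ≥0∞)

/-- The expected number of reduction steps of an evaluation. -/
def Evaluation.length {P : Program ι F} {e : Expr ι F} (E : Evaluation P e) : ℝ≥0∞ :=
  ∑' n, ((E.state n).activeProb P : ℝ≥0∞)

/-- The (sub)distribution over values reached in the limit. The approximations increase with `n`,
since values are normal forms. -/
def Evaluation.limit {P : Program ι F} {e : Expr ι F} (E : Evaluation P e) (v : Val ι) : ℝ≥0∞ :=
  ⨆ n, ((E.state n).valueProb v : ℝ≥0∞)

end Operations

/-! ### Annotations and potential -/

/-- Resource annotations over the tree variables (or positions) in `X`: the coefficients of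
`rank x`, and those of the functions `log (∑ aₓ · |x| + b)`, all of them non-negative. -/
abbrev Ann (X : Type) : Type := (X →₀ ℝ≥0) × (((X →₀ ℕ) × ℤ) →₀ ℝ≥0)

/-- Coefficients of the ranks. -/
abbrev Ann.rk {X : Type} (Q : Ann X) : X →₀ ℝ≥0 := Q.1

/-- Coefficients of the logarithmic resource functions. -/
abbrev Ann.lg {X : Type} (Q : Ann X) : ((X →₀ ℕ) × ℤ) →₀ ℝ≥0 := Q.2

/-- The annotation of the constant potential `K = K · log (0 + 2)`. -/
def Ann.const {X : Type} (K : ℝ≥0) : Ann X := (0, Finsupp.single (0, 2) K)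

/-- Replace every variable `x` by `g x`; coefficients which then agree in their index are added. -/
def Ann.map {X Y : Type} (g : X → Y) (Q : Ann X) : Ann Y :=
  (Q.rk.mapDomain g, Q.lg.mapDomain fun i => (i.1.mapDomain g, i.2))

/-- The sum `∑ aₓ` of an index. -/
def idxSum {X : Type} (a : X →₀ ℕ) : ℤ := a.sum fun _ n => (n : ℤ)

/-- `Q` is an annotation for the trees in `s`: other variables do not occur, and all logarithms
are taken of numbers which are at least one. -/
def Ann.For {X : Type} (Q : Ann X) (s : Set X) : Prop :=
  (∀ x ∈ Q.rk.support, x ∈ s) ∧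
  ∀ i ∈ Q.lg.support, (∀ x ∈ i.1.support, x ∈ s) ∧ 1 ≤ idxSum i.1 + i.2

/-- The potential of an annotation, for given values of the variables. -/
def Ann.potential {X : Type} {ι : Type} [BaseTypes ι] (Q : Ann X) (σ : X → Val ι) : ℝ :=
  (Q.rk.sum fun x q => (q : ℝ) * (σ x).rank) +
  Q.lg.sum fun i q =>
    (q : ℝ) * Real.logb 2 ((i.1.sum fun x n => (n : ℝ) * ((σ x).size : ℝ)) + (i.2 : ℝ))

/-- The annotation of the remaining variables if the variable `x` is dropped. -/
def Ann.drop {X : Type} (x : X) (Q : Ann X) : Ann X :=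
  (Q.rk.erase x, Q.lg.filter fun i => i.1 x = 0)

/-- The annotation if the tree `x` is known to be a leaf (of rank and size one). -/
def Ann.atLeaf {X : Type} (x : X) (Q : Ann X) : Ann X :=
  (Q.rk.erase x, Q.lg.mapDomain fun i => (i.1.erase x, (i.1 x : ℤ) + i.2)) + Ann.const (Q.rk x)

/-- The annotation if the tree `x` is known to be a node with subtrees `y` and `z`. -/
def Ann.atNode {X : Type} (x y z : X) (Q : Ann X) : Ann X :=
  (Q.rk.erase x + Finsupp.single y (Q.rk x) + Finsupp.single z (Q.rk x),
   (Q.lg.mapDomain fun i =>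
      (i.1.erase x + Finsupp.single y (i.1 x) + Finsupp.single z (i.1 x), i.2)) +
    Finsupp.single (Finsupp.single y 1, 0) (Q.rk x) +
    Finsupp.single (Finsupp.single z 1, 0) (Q.rk x))

/-! ### The type system -/

/-- Typing contexts. -/
abbrev Ctx (ι : Type) : Type := Var → Option (Ty ι)

/-- The empty context. -/
def Ctx.empty {ι : Type} : Ctx ι := fun _ => none

/-- `Γ, x : α` (used for `x` outside of the domain of `Γ`). -/
def Ctx.extend {ι : Type} (Γ : Ctx ι) (x : Var) (α : Ty ι) : Ctx ι :=
  Function.update Γ x (some α)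

/-- `Γ, Δ` (used for disjoint domains). -/
def Ctx.join {ι : Type} (Γ Δ : Ctx ι) : Ctx ι := fun x => (Γ x).or (Δ x)

/-- The domains are disjoint. -/
def Ctx.Disjoint {ι : Type} (Γ Δ : Ctx ι) : Prop := ∀ x, Γ x = none ∨ Δ x = none

/-- The context `x₁ : α₁, ..., xₙ : αₙ`. -/
def Ctx.ofLists {ι : Type} (xs : List Var) (αs : List (Ty ι)) : Ctx ι :=
  fun x => (xs.zip αs).lookup x

/-- The variables of a context whose values contain exactly one tree. -/
def Ctx.treeVars {ι : Type} (Γ : Ctx ι) : Set Var := {x | ∃ α, Γ x = some α ∧ α.numTrees = 1}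

/-- The only place of an annotation for results of type `α`, if results contain exactly one
tree. -/
def Ty.slot {ι : Type} (α : Ty ι) : Set Unit := {_u | α.numTrees = 1}

/-- The substitution respects the context. -/
def Ctx.Respects {ι : Type} [BaseTypes ι] (Γ : Ctx ι) (σ : Var → Val ι) : Prop :=
  ∀ x α, Γ x = some α → (σ x).HasType α

/-- The three variants of the type system: with costs, cost-free (ticks are ignored), and
cost-free for the non-deterministic variant of programs (in addition, coin tosses are read as
non-deterministic choices). -/
inductive Mode : Type
  | costed
  | costFree
  | costFreeNondet

/-- Annotated function types `α₁ × ... × αₙ | Q → β | Q'`. In `Q`, the arguments are referred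
to by their positions `0, ..., n - 1`. -/
structure FunType (ι : Type) where
  args : List (Ty ι)
  dom : Ann ℕ
  res : Ty ι
  cod : Ann Unit

/-- The annotation of the arguments concerns arguments with one tree only. -/
def FunType.WF {ι : Type} (s : FunType ι) : Prop :=
  s.dom.For {i | ∃ α, s.args[i]? = some α ∧ α.numTrees = 1} ∧ s.cod.For s.res.slot

/-- Annotated signatures: a set of annotated types of every function, for each variant. -/
abbrev Signature (ι F : Type) : Type := Mode → F → Set (FunType ι)

/-- What ticking with cost `c` takes from the potential. -/
def Mode.tickCost (m : Mode) (c : ℚ≥0) : ℝ≥0 :=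
  match m with
  | .costed => (c : ℝ≥0)
  | .costFree => 0
  | .costFreeNondet => 0

/-- The signatures that may be added with a factor to those of a function call. -/
def Mode.free : Mode → Mode
  | .costed => .costFree
  | .costFree => .costFree
  | .costFreeNondet => .costFreeNondet

/-- Index `(b, d, e)` of the potential `log (∑ b_y · |y| + d · |x| + e)` of the body of
`let x = ... in ...`. -/
abbrev CrossIdx : Type := (Var →₀ ℕ) × ℕ × ℤ

/-- The potential of the body for a let-bound variable `x`: coefficient `w` for index `k`. -/
def crossBody (x : Var) (k : CrossIdx) (w : ℝ≥0) : Ann Var :=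
  (0, Finsupp.single (k.1 + Finsupp.single x k.2.1, k.2.2) w)

/-- The result annotation in the auxiliary judgement for the index `k`. -/
def crossRes (k : CrossIdx) (w : ℝ≥0) : Ann Unit :=
  (0, Finsupp.single (Finsupp.single () k.2.1, max k.2.2 0) w)

/-- The potential of the whole let-expression that pays for the index `k`: all indices `(a, c)`
of the auxiliary annotation `A` become `(a, b, c - max {-e, 0})`. -/
def crossTotal (k : CrossIdx) (A : Ann Var) : Ann Var :=
  (0, A.lg.mapDomain fun i => (i.1 + k.1, i.2 - max (-k.2.2) 0))

/-- The numerical conditions on the auxiliary judgement for the index `k` and the coefficient `w`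
of the body; `Δ` is the context of the other variables of the body. -/
def CrossOK {ι : Type} (Δ : Ctx ι) (k : CrossIdx) (A : Ann Var) (w : ℝ≥0) : Prop :=
  k.1 ≠ 0 ∧ (∀ y ∈ k.1.support, y ∈ Δ.treeVars) ∧ k.2.1 ≠ 0 ∧
  1 ≤ idxSum k.1 + k.2.1 + k.2.2 ∧ 0 ≤ idxSum k.1 + k.2.2 ∧
  A.rk = 0 ∧ (∀ c, A.lg (0, c) = 0) ∧
  w ≤ (A.lg.sum fun _ q => q) ∧ ∀ i, A.lg i ≠ 0 → w ≤ A.lg i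

/-- The typing judgement `Γ | Q ⊢ e : α | Q'`. -/
inductive Typed {ι : Type} [BaseTypes ι] {F : Type} (S : Signature ι F) :
    Mode → Ctx ι → Ann Var → Expr ι F → Ty ι → Ann Unit → Prop
  | var (m : Mode) (x : Var) (α : Ty ι) (Q' : Ann Unit) : Q'.For α.slot →
      Typed S m (Ctx.empty.extend x α) (Q'.map fun _ => x) (.ret (.var x)) α Q'
  | const (m : Mode) (b : Base ι) (a : b.Elem) (Q' : Ann Unit) : Q'.For (Ty.base b).slot →
      Typed S m Ctx.empty (Q'.map fun _ => 0) (.const b a) (.base b) Q'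
  | leaf (m : Mode) (b : Base ι) (Q' : Ann Unit) : Q'.For (Ty.tree b).slot →
      Typed S m Ctx.empty ((Q'.atLeaf ()).map fun _ => 0) .leaf (.tree b) Q'
  | node (m : Mode) (b : Base ι) (x₁ x₂ x₃ : Var) (Q' : Ann Unit) :
      [x₁, x₂, x₃].Nodup → Q'.For (Ty.tree b).slot →
      Typed S m (Ctx.ofLists [x₁, x₂, x₃] [.tree b, .base b, .tree b])
        ((Q'.map fun _ => x₁).atNode x₁ x₁ x₃)
        (.node (.var x₁) (.var x₂) (.var x₃)) (.tree b) Q'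
  | cmp (m : Mode) (op : Cmp) (b : Base ι) (x₁ x₂ : Var) (Q' : Ann Unit) : x₁ ≠ x₂ →
      Q'.For (Ty.bool (ι := ι)).slot →
      Typed S m (Ctx.ofLists [x₁, x₂] [.base b, .base b]) (Q'.map fun _ => x₁)
        (.cmp op (.var x₁) (.var x₂)) .bool Q'
  | pair (m : Mode) (α₁ α₂ : Ty ι) (x₁ x₂ : Var) (Q' : Ann Unit) : x₁ ≠ x₂ →
      α₁.numTrees + α₂.numTrees ≤ 1 → Q'.For (Ty.prod α₁ α₂).slot →
      Typed S m (Ctx.ofLists [x₁, x₂] [α₁, α₂])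
        (Q'.map fun _ => if α₁.numTrees = 1 then x₁ else x₂)
        (.pair (.var x₁) (.var x₂)) (.prod α₁ α₂) Q'
  | ite (m : Mode) (Γ : Ctx ι) (x : Var) (Q : Ann Var) (e₁ e₂ : Expr ι F) (α : Ty ι)
      (Q' : Ann Unit) : Γ x = none →
      Typed S m Γ Q e₁ α Q' → Typed S m Γ Q e₂ α Q' →
      Typed S m (Γ.extend x .bool) Q (.ite (.var x) e₁ e₂) α Q'
  | nondet (m : Mode) (Γ : Ctx ι) (Q : Ann Var) (e₁ e₂ : Expr ι F) (α : Ty ι) (Q' : Ann Unit) :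
      Typed S m Γ Q e₁ α Q' → Typed S m Γ Q e₂ α Q' →
      Typed S m Γ Q (.nondet e₁ e₂) α Q'
  | coin (m : Mode) (Γ : Ctx ι) (p : ℚ≥0) (hp : p ≤ 1) (Q₁ Q₂ : Ann Var) (e₁ e₂ : Expr ι F)
      (α : Ty ι) (Q' : Ann Unit) : m ≠ .costFreeNondet →
      Typed S m Γ Q₁ e₁ α Q' → Typed S m Γ Q₂ e₂ α Q' →
      Typed S m Γ ((p : ℝ≥0) • Q₁ + (1 - (p : ℝ≥0)) • Q₂) (.coin p hp e₁ e₂) α Q'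
  | coinNondet (Γ : Ctx ι) (p : ℚ≥0) (hp : p ≤ 1) (Q : Ann Var) (e₁ e₂ : Expr ι F)
      (α : Ty ι) (Q' : Ann Unit) :
      Typed S .costFreeNondet Γ Q e₁ α Q' → Typed S .costFreeNondet Γ Q e₂ α Q' →
      Typed S .costFreeNondet Γ Q (.coin p hp e₁ e₂) α Q'
  | tickNow (m : Mode) (Γ : Ctx ι) (Q : Ann Var) (c : ℚ≥0) (e : Expr ι F) (α : Ty ι)
      (Q' : Ann Unit) : Typed S m Γ Q e α Q' →
      Typed S m Γ (Q + Ann.const (m.tickCost c)) (.tick c e) α Q'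
  | matchTree (m : Mode) (Γ : Ctx ι) (b : Base ι) (x y₁ y₂ y₃ : Var) (Q : Ann Var)
      (e₁ e₂ : Expr ι F) (α : Ty ι) (Q' : Ann Unit) : Γ x = none →
      [y₁, y₂, y₃].Nodup → Γ y₁ = none → Γ y₂ = none → Γ y₃ = none →
      Q.For (Γ.extend x (.tree b)).treeVars →
      Typed S m Γ (Q.atLeaf x) e₁ α Q' →
      Typed S m (((Γ.extend y₁ (.tree b)).extend y₂ (.base b)).extend y₃ (.tree b))
        (Q.atNode x y₁ y₃) e₂ α Q' →
      Typed S m (Γ.extend x (.tree b)) Q (.matchTree (.var x) e₁ y₁ y₂ y₃ e₂) α Q'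
  | matchPair (m : Mode) (Γ : Ctx ι) (α₁ α₂ : Ty ι) (x y₁ y₂ : Var) (Q : Ann Var)
      (e : Expr ι F) (β : Ty ι) (Q' : Ann Unit) : Γ x = none →
      y₁ ≠ y₂ → Γ y₁ = none → Γ y₂ = none → α₁.numTrees + α₂.numTrees ≤ 1 →
      Q.For (Γ.extend x (.prod α₁ α₂)).treeVars →
      Typed S m ((Γ.extend y₁ α₁).extend y₂ α₂)
        (Q.map fun v => if v = x then (if α₁.numTrees = 1 then y₁ else y₂) else v) e β Q' →
      Typed S m (Γ.extend x (.prod α₁ α₂)) Q (.matchPair (.var x) y₁ y₂ e) β Q'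
  | letBase (m : Mode) (Γ Δ : Ctx ι) (x : Var) (P D : Ann Var) (P' : Ann Unit)
      (e₁ e₂ : Expr ι F) (α β : Ty ι) (Q' : Ann Unit) : Γ.Disjoint Δ → Δ x = none →
      α.numTrees ≠ 1 → D.For Δ.treeVars → (∀ c, D.lg (0, c) = 0) →
      Typed S m Γ P e₁ α P' →
      Typed S m (Δ.extend x α) (D + P'.map fun _ => x) e₂ β Q' →
      Typed S m (Γ.join Δ) (P + D) (.letIn x e₁ e₂) β Q'
  | letTree (m : Mode) (Γ Δ : Ctx ι) (x : Var) (P D : Ann Var) (P' : Ann Unit)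
      (I : Finset CrossIdx) (A : CrossIdx → Ann Var) (w : CrossIdx → ℝ≥0)
      (e₁ e₂ : Expr ι F) (α β : Ty ι) (Q' : Ann Unit) : Γ.Disjoint Δ → Δ x = none →
      α.numTrees = 1 → D.For Δ.treeVars → (∀ c, D.lg (0, c) = 0) →
      Typed S m Γ P e₁ α P' →
      (∀ k ∈ I, CrossOK Δ k (A k) (w k)) →
      (∀ k ∈ I, Typed S .costFreeNondet Γ (A k) e₁ α (crossRes k (w k))) →
      Typed S m (Δ.extend x α) (D + P'.map (fun _ => x) + ∑ k ∈ I, crossBody x k (w k)) e₂ β Q' →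
      Typed S m (Γ.join Δ) (P + D + ∑ k ∈ I, crossTotal k (A k)) (.letIn x e₁ e₂) β Q'
  | app (m : Mode) (f : F) (xs : List Var) (αs : List (Ty ι)) (β : Ty ι) (P Q : Ann ℕ)
      (P' Q' : Ann Unit) (K : ℝ≥0) : xs.Nodup → xs.length = αs.length →
      FunType.WF ⟨αs, P, β, P'⟩ → FunType.WF ⟨αs, Q, β, Q'⟩ →
      ⟨αs, P, β, P'⟩ ∈ S m f → ⟨αs, Q, β, Q'⟩ ∈ S m.free f →
      Typed S m (Ctx.ofLists xs αs) ((P + K • Q).map fun i => xs.getD i 0)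
        (.app f (xs.map Opd.var)) β (P' + K • Q')
  | weakenVar (m : Mode) (Γ : Ctx ι) (x : Var) (α : Ty ι) (Q : Ann Var) (e : Expr ι F) (β : Ty ι)
      (Q' : Ann Unit) : Γ x = none → Q.For (Γ.extend x α).treeVars →
      Typed S m Γ (Q.drop x) e β Q' →
      Typed S m (Γ.extend x α) Q e β Q'
  | share (m : Mode) (Γ : Ctx ι) (x y z : Var) (α : Ty ι) (Q : Ann Var) (e : Expr ι F) (β : Ty ι)
      (Q' : Ann Unit) : Γ x = none → Γ y = none → Γ z = none → x ≠ y →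
      e.NoCapture (fun v => if v = x ∨ v = y then z else v) →
      Typed S m ((Γ.extend x α).extend y α) Q e β Q' →
      Typed S m (Γ.extend z α) (Q.map fun v => if v = x ∨ v = y then z else v)
        (e.rename fun v => if v = x ∨ v = y then z else v) β Q'
  | weaken (m : Mode) (Γ : Ctx ι) (P Q : Ann Var) (e : Expr ι F) (α : Ty ι) (P' Q' : Ann Unit) :
      Q.For Γ.treeVars → Q'.For α.slot →
      (∀ σ : Var → Val ι, Γ.Respects σ → P.potential σ ≤ Q.potential σ) →
      (∀ v : Val ι, v.HasType α → Q'.potential (fun _ => v) ≤ P'.potential (fun _ => v)) →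
      Typed S m Γ P e α P' →
      Typed S m Γ Q e α Q'
  | shift (m : Mode) (Γ : Ctx ι) (Q : Ann Var) (e : Expr ι F) (α : Ty ι) (Q' : Ann Unit)
      (K : ℝ≥0) : Typed S m Γ Q e α Q' →
      Typed S m Γ (Q + Ann.const K) e α (Q' + Ann.const K)

section Main

variable {ι : Type} [BaseTypes ι] {F : Type}

/-- The program is well-typed: every function body has all the annotated types which the
signature lists for the function, in each variant of the type system. -/
def Program.WellTyped (P : Program ι F) (S : Signature ι F) : Prop :=
  ∀ m f, ∀ s ∈ S m f, s.WF ∧ s.args.length = (P.params f).length ∧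
    Typed S m (Ctx.ofLists (P.params f) s.args) (s.dom.map fun i => (P.params f).getD i 0)
      (P.body f) s.res s.cod

/-- Positive almost sure termination: every evaluation of every instance has finite expected
cost and finite expected length. -/
def PositivelyAlmostSurelyTerminating (P : Program ι F) (Γ : Ctx ι) (e : Expr ι F) : Prop :=
  ∀ σ : Var → Val ι, Γ.Respects σ → ∀ E : Evaluation P (e.inst σ), E.cost < ⊤ ∧ E.length < ⊤

/-- Almost sure termination: every evaluation of every instance leads to a full distribution over
values. -/
def AlmostSurelyTerminating (P : Program ι F) (Γ : Ctx ι) (e : Expr ι F) : Prop :=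
  ∀ σ : Var → Val ι, Γ.Respects σ → ∀ E : Evaluation P (e.inst σ), ∑' v, E.limit v = 1

end Main

end

/-! Potential pays for evaluation. For fuel `n`, `worst` is the supremum, over all resolutions of
the non-determinism, of the expected cost of `n` steps plus the expectation of a payoff at the
values reached; stuck expressions count as `⊤`. Soundness (`Program.WellTyped.worst_le`) says that,
with the potential of the result as payoff, this never exceeds the potential of the context,
whatever the fuel. The proof is an induction on the fuel and, for fixed fuel, on the typing
derivation. A call uses up fuel, so recursion is harmless: function bodies fall under the outer
induction.

The delicate rule is `let` with a tree-valued variable, because the potential of its body may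
contain terms `log (∑ b_y |y| + d |x| + e)` that mix the new tree with old ones. A bound in
expectation on the part with `x` alone does not survive adding `∑ b_y |y|` inside the logarithm. The
auxiliary derivations read coin tosses as choices and therefore bound every reached value
separately. Such a pointwise bound can be shifted: `w log b ≤ ∑ qᵢ log aᵢ` with all `qᵢ ≥ w` implies
the same with `B ≥ 0` added to all arguments (`log_shift`, by Bernoulli's inequality).
`CrossOK.potential_le` applies this to annotations, and `worst_nondet_le_of_imp` carries the
implication along an evaluation.

Hence the expected cost is at most the initial potential, which is finite. For the length, the
measure `Expr.freeSteps` satisfies `1 + E[after] ≤ before + 2 * cost` at each step, because a tick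
of cost at least one pays for itself and for the one step right below it. Summing up, the expected
length is at most `e.freeSteps + 2 * cost`; only the program has to be ticked, not `e`.

A finite length forces the probability of reducible expressions to tend to zero. Stuck expressions
have probability zero, since otherwise `worst` would be infinite. So all mass ends up on values. -/

noncomputable section

/-! ### Substitution and renaming -/

section Substitution

variable {ι : Type} [BaseTypes ι] {F : Type}

theorem Opd.subst_congr {σ τ : Var → Option (Val ι)} {o : Opd ι} (h : ∀ x ∈ o.fv, σ x = τ x) :
    o.subst σ = o.subst τ := by
  cases o with
  | var x => simp [Opd.subst, h x (by simp [Opd.fv])]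
  | val v => rfl

theorem Expr.subst_congr {e : Expr ι F} : ∀ {σ τ : Var → Option (Val ι)},
    (∀ x ∈ e.fv, σ x = τ x) → e.subst σ = e.subst τ := by
  induction e with
  | ret o => intro σ τ h; simp only [Expr.subst]; rw [Opd.subst_congr h]
  | const b x => intro σ τ h; rfl
  | leaf => intro σ τ h; rfl
  | node l d r =>
    intro σ τ h
    simp only [Expr.fv, Set.mem_union] at h
    simp only [Expr.subst]
    rw [Opd.subst_congr fun x hx => h x (by tauto), Opd.subst_congr fun x hx => h x (by tauto),
      Opd.subst_congr (o := r) fun x hx => h x (by tauto)]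
  | pair a b =>
    intro σ τ h
    simp only [Expr.fv, Set.mem_union] at h
    simp only [Expr.subst]
    rw [Opd.subst_congr fun x hx => h x (by tauto),
      Opd.subst_congr (o := b) fun x hx => h x (by tauto)]
  | cmp op a b =>
    intro σ τ h
    simp only [Expr.fv, Set.mem_union] at h
    simp only [Expr.subst]
    rw [Opd.subst_congr fun x hx => h x (by tauto),
      Opd.subst_congr (o := b) fun x hx => h x (by tauto)]
  | app f args =>
    intro σ τ h
    simp only [Expr.subst, Expr.app.injEq, true_and]
    exact List.map_congr_left fun o ho => Opd.subst_congr fun x hx => h x ⟨o, ho, hx⟩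
  | tick c e ih => intro σ τ h; simp only [Expr.subst]; rw [ih h]
  | ite o e₁ e₂ ih₁ ih₂ =>
    intro σ τ h
    simp only [Expr.fv, Set.mem_union] at h
    simp only [Expr.subst]
    rw [Opd.subst_congr fun x hx => h x (by tauto), ih₁ fun x hx => h x (by tauto),
      ih₂ fun x hx => h x (by tauto)]
  | nondet e₁ e₂ ih₁ ih₂ =>
    intro σ τ h
    simp only [Expr.fv, Set.mem_union] at h
    simp only [Expr.subst]
    rw [ih₁ fun x hx => h x (by tauto), ih₂ fun x hx => h x (by tauto)]
  | coin p hp e₁ e₂ ih₁ ih₂ =>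
    intro σ τ h
    simp only [Expr.fv, Set.mem_union] at h
    simp only [Expr.subst]
    rw [ih₁ fun x hx => h x (by tauto), ih₂ fun x hx => h x (by tauto)]
  | matchTree o e₁ y₁ y₂ y₃ e₂ ih₁ ih₂ =>
    intro σ τ h
    simp only [Expr.fv, Set.mem_union, Set.mem_sdiff, Set.mem_insert_iff,
      Set.mem_singleton_iff] at h
    simp only [Expr.subst]
    rw [Opd.subst_congr fun x hx => h x (by tauto), ih₁ fun x hx => h x (by tauto), ih₂]
    intro x hx
    split_ifs with hx'
    · rfl
    · exact h x (by tauto)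
  | matchPair o y₁ y₂ e ih =>
    intro σ τ h
    simp only [Expr.fv, Set.mem_union, Set.mem_sdiff, Set.mem_insert_iff,
      Set.mem_singleton_iff] at h
    simp only [Expr.subst]
    rw [Opd.subst_congr fun x hx => h x (by tauto), ih]
    intro x hx
    split_ifs with hx'
    · rfl
    · exact h x (by tauto)
  | letIn y e₁ e₂ ih₁ ih₂ =>
    intro σ τ h
    simp only [Expr.fv, Set.mem_union, Set.mem_sdiff, Set.mem_singleton_iff] at h
    simp only [Expr.subst]
    rw [ih₁ fun x hx => h x (by tauto), ih₂]
    intro x hx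
    split_ifs with hx'
    · rfl
    · exact h x (by tauto)

theorem Opd.subst_subst (σ τ : Var → Option (Val ι)) (o : Opd ι) :
    (o.subst σ).subst τ = o.subst fun x => (σ x).or (τ x) := by
  cases o with
  | var x => cases h : σ x <;> simp [Opd.subst, h]
  | val v => rfl

/-- Only closed values are substituted, so nothing can be captured, and a variable hit by `σ` is
gone before `τ` acts. -/
theorem Expr.subst_subst (e : Expr ι F) : ∀ σ τ : Var → Option (Val ι),
    (e.subst σ).subst τ = e.subst fun x => (σ x).or (τ x) := by
  induction e with
  | matchTree o e₁ y₁ y₂ y₃ e₂ ih₁ ih₂ =>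
    intro σ τ
    simp only [Expr.subst, Opd.subst_subst, ih₁, ih₂]
    congr 2
    ext x : 1
    split_ifs <;> simp
  | matchPair o y₁ y₂ e ih =>
    intro σ τ
    simp only [Expr.subst, Opd.subst_subst, ih]
    congr 2
    ext x : 1
    split_ifs <;> simp
  | letIn y e₁ e₂ ih₁ ih₂ =>
    intro σ τ
    simp only [Expr.subst, ih₁, ih₂]
    congr 2
    ext x : 1
    split_ifs <;> simp
  | app f args =>
    intro σ τ
    simp only [Expr.subst, List.map_map, Expr.app.injEq, true_and]
    exact List.map_congr_left fun o _ => Opd.subst_subst σ τ o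
  | _ => intro σ τ; simp_all [Expr.subst, Opd.subst_subst]

theorem Opd.subst_rename {ρ : Var → Var} {τ : Var → Option (Val ι)} {o : Opd ι}
    (h : ∀ x ∈ o.fv, τ (ρ x) = none → ρ x = x) :
    (o.rename ρ).subst τ = o.subst fun x => τ (ρ x) := by
  cases o with
  | var x =>
    cases hx : τ (ρ x) with
    | none => simp [Opd.rename, Opd.subst, h x (by simp [Opd.fv]) hx]
    | some v => simp [Opd.rename, Opd.subst, hx]
  | val v => rfl

/-- The second hypothesis is needed because a variable missed by `τ` remains as `ρ x` on the left
but as `x` on the right. It is stated in this form, rather than for total `τ`, so that it passes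
below binders, where bound variables are fixed by the renaming and spared by the substitution. -/
theorem Expr.subst_rename {e : Expr ι F} : ∀ {ρ : Var → Var} {τ : Var → Option (Val ι)},
    e.NoCapture ρ → (∀ x ∈ e.fv, τ (ρ x) = none → ρ x = x) →
    (e.rename ρ).subst τ = e.subst fun x => τ (ρ x) := by
  induction e with
  | ret o =>
    intro ρ τ h hf
    simp only [Expr.subst, Expr.rename]
    rw [Opd.subst_rename hf]
  | const b x => intros; rfl
  | leaf => intros; rfl
  | node l d r =>
    intro ρ τ h hf
    simp only [Expr.fv, Set.mem_union] at hf
    simp only [Expr.subst, Expr.rename]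
    rw [Opd.subst_rename fun x hx => hf x (by tauto), Opd.subst_rename fun x hx => hf x (by tauto),
      Opd.subst_rename (o := r) fun x hx => hf x (by tauto)]
  | pair a b =>
    intro ρ τ h hf
    simp only [Expr.fv, Set.mem_union] at hf
    simp only [Expr.subst, Expr.rename]
    rw [Opd.subst_rename fun x hx => hf x (by tauto),
      Opd.subst_rename (o := b) fun x hx => hf x (by tauto)]
  | cmp op a b =>
    intro ρ τ h hf
    simp only [Expr.fv, Set.mem_union] at hf
    simp only [Expr.subst, Expr.rename]
    rw [Opd.subst_rename fun x hx => hf x (by tauto),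
      Opd.subst_rename (o := b) fun x hx => hf x (by tauto)]
  | app f args =>
    intro ρ τ h hf
    simp only [Expr.subst, Expr.rename, List.map_map, Expr.app.injEq, true_and]
    exact List.map_congr_left fun o ho => Opd.subst_rename fun x hx => hf x ⟨o, ho, hx⟩
  | tick c e ih => intro ρ τ h hf; simp only [Expr.subst, Expr.rename]; rw [ih h hf]
  | ite o e₁ e₂ ih₁ ih₂ =>
    intro ρ τ h hf
    simp only [Expr.fv, Set.mem_union] at hf
    simp only [Expr.subst, Expr.rename]
    rw [Opd.subst_rename fun x hx => hf x (by tauto), ih₁ h.1 fun x hx => hf x (by tauto),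
      ih₂ h.2 fun x hx => hf x (by tauto)]
  | nondet e₁ e₂ ih₁ ih₂ =>
    intro ρ τ h hf
    simp only [Expr.fv, Set.mem_union] at hf
    simp only [Expr.subst, Expr.rename]
    rw [ih₁ h.1 fun x hx => hf x (by tauto), ih₂ h.2 fun x hx => hf x (by tauto)]
  | coin p hp e₁ e₂ ih₁ ih₂ =>
    intro ρ τ h hf
    simp only [Expr.fv, Set.mem_union] at hf
    simp only [Expr.subst, Expr.rename]
    rw [ih₁ h.1 fun x hx => hf x (by tauto), ih₂ h.2 fun x hx => hf x (by tauto)]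
  | matchTree o e₁ y₁ y₂ y₃ e₂ ih₁ ih₂ =>
    intro ρ τ h hf
    simp only [Expr.NoCapture, Set.mem_sdiff, Set.mem_insert_iff, Set.mem_singleton_iff] at h
    simp only [Expr.fv, Set.mem_union, Set.mem_sdiff, Set.mem_insert_iff,
      Set.mem_singleton_iff] at hf
    simp only [Expr.subst, Expr.rename]
    rw [Opd.subst_rename fun x hx => hf x (by tauto), ih₁ h.1 fun x hx => hf x (by tauto),
      ih₂ h.2.2]
    · congr 1
      apply Expr.subst_congr
      intro x hx
      by_cases hxy : x = y₁ ∨ x = y₂ ∨ x = y₃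
      · simp [hxy]
      · simp [hxy, h.2.1 x ⟨hx, hxy⟩]
    · intro x hx
      by_cases hxy : x = y₁ ∨ x = y₂ ∨ x = y₃
      · simp [hxy]
      · simpa [hxy, h.2.1 x ⟨hx, hxy⟩] using hf x (by tauto)
  | matchPair o y₁ y₂ e ih =>
    intro ρ τ h hf
    simp only [Expr.NoCapture, Set.mem_sdiff, Set.mem_insert_iff, Set.mem_singleton_iff] at h
    simp only [Expr.fv, Set.mem_union, Set.mem_sdiff, Set.mem_insert_iff,
      Set.mem_singleton_iff] at hf
    simp only [Expr.subst, Expr.rename]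
    rw [Opd.subst_rename fun x hx => hf x (by tauto), ih h.2]
    · congr 1
      apply Expr.subst_congr
      intro x hx
      by_cases hxy : x = y₁ ∨ x = y₂
      · simp [hxy]
      · simp [hxy, h.1 x ⟨hx, hxy⟩]
    · intro x hx
      by_cases hxy : x = y₁ ∨ x = y₂
      · simp [hxy]
      · simpa [hxy, h.1 x ⟨hx, hxy⟩] using hf x (by tauto)
  | letIn y e₁ e₂ ih₁ ih₂ =>
    intro ρ τ h hf
    simp only [Expr.NoCapture, Set.mem_sdiff, Set.mem_singleton_iff] at h
    simp only [Expr.fv, Set.mem_union, Set.mem_sdiff, Set.mem_singleton_iff] at hf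
    simp only [Expr.subst, Expr.rename]
    rw [ih₁ h.1 fun x hx => hf x (by tauto), ih₂ h.2.2]
    · congr 1
      apply Expr.subst_congr
      intro x hx
      by_cases hxy : x = y
      · simp [hxy]
      · simp [hxy, h.2.1 x ⟨hx, hxy⟩]
    · intro x hx
      by_cases hxy : x = y
      · simp [hxy]
      · simpa [hxy, h.2.1 x ⟨hx, hxy⟩] using hf x (by tauto)

theorem Expr.inst_rename {e : Expr ι F} {ρ : Var → Var} (h : e.NoCapture ρ) (σ : Var → Val ι) :
    (e.rename ρ).inst σ = e.inst fun x => σ (ρ x) :=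
  Expr.subst_rename h (by simp)

theorem Opd.fv_rename (ρ : Var → Var) (o : Opd ι) : (o.rename ρ).fv = ρ '' o.fv := by
  cases o <;> simp [Opd.rename, Opd.fv]

theorem Expr.fv_rename_subset (e : Expr ι F) : ∀ ρ : Var → Var,
    ∀ z ∈ (e.rename ρ).fv, ∃ x ∈ e.fv, ρ x = z := by
  induction e with
  | app f args =>
    rintro ρ z ⟨o, ho, hz⟩
    obtain ⟨o', ho', rfl⟩ := List.mem_map.mp ho
    rw [Opd.fv_rename] at hz
    obtain ⟨x, hx, rfl⟩ := hz
    exact ⟨x, ⟨o', ho', hx⟩, rfl⟩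
  | matchTree o e₁ y₁ y₂ y₃ e₂ ih₁ ih₂ =>
    intro ρ z hz
    simp only [Expr.rename, Expr.fv, Opd.fv_rename, Set.mem_union, Set.mem_image, Set.mem_sdiff,
      Set.mem_insert_iff, Set.mem_singleton_iff] at hz ⊢
    rcases hz with (⟨x, hx, rfl⟩ | hz) | ⟨hz, hz'⟩
    · exact ⟨x, by tauto, rfl⟩
    · obtain ⟨x, hx, rfl⟩ := ih₁ ρ z hz
      exact ⟨x, by tauto, rfl⟩
    · obtain ⟨x, hx, rfl⟩ := ih₂ _ z hz
      split_ifs at hz' ⊢ with hxy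
      · exact absurd hxy hz'
      exact ⟨x, by tauto, rfl⟩
  | matchPair o y₁ y₂ e ih =>
    intro ρ z hz
    simp only [Expr.rename, Expr.fv, Opd.fv_rename, Set.mem_union, Set.mem_image, Set.mem_sdiff,
      Set.mem_insert_iff, Set.mem_singleton_iff] at hz ⊢
    rcases hz with ⟨x, hx, rfl⟩ | ⟨hz, hz'⟩
    · exact ⟨x, by tauto, rfl⟩
    · obtain ⟨x, hx, rfl⟩ := ih _ z hz
      split_ifs at hz' ⊢ with hxy
      · exact absurd hxy hz'
      exact ⟨x, by tauto, rfl⟩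
  | letIn y e₁ e₂ ih₁ ih₂ =>
    intro ρ z hz
    simp only [Expr.rename, Expr.fv, Set.mem_union, Set.mem_sdiff,
      Set.mem_singleton_iff] at hz ⊢
    rcases hz with hz | ⟨hz, hz'⟩
    · obtain ⟨x, hx, rfl⟩ := ih₁ ρ z hz
      exact ⟨x, by tauto, rfl⟩
    · obtain ⟨x, hx, rfl⟩ := ih₂ _ z hz
      split_ifs at hz' ⊢ with hxy
      · exact absurd hxy hz'
      exact ⟨x, by tauto, rfl⟩
  | _ =>
    intro ρ z hz
    simp only [Expr.rename, Expr.fv, Opd.fv_rename, Set.mem_union, Set.mem_image,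
      Set.mem_empty_iff_false] at hz ⊢ <;> grind

theorem Expr.inst_letIn (σ : Var → Val ι) (x : Var) (e₁ e₂ : Expr ι F) :
    (Expr.letIn x e₁ e₂).inst σ = .letIn x (e₁.inst σ)
      (e₂.subst fun y => if y = x then none else some (σ y)) := rfl

/-- Brings the reducts of `let` and `match` back to the form `e.inst σ'` in which soundness is
stated; `p` describes the bound variables. -/
theorem Expr.subst_bindings_eq_inst {e : Expr ι F} {σ σ' : Var → Val ι}
    {p : Var → Prop} [DecidablePred p] {xs : List Var} {vs : List (Val ι)}
    (h : ∀ x, p x → bindings xs vs x = some (σ' x)) (h' : ∀ x, ¬ p x → σ' x = σ x) :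
    (e.subst fun x => if p x then none else some (σ x)).subst (bindings xs vs) = e.inst σ' := by
  rw [Expr.subst_subst, Expr.inst]
  congr 1
  ext x : 1
  by_cases hx : p x
  · simp [hx, h x hx]
  · simp [hx, h' x hx]

end Substitution

/-! ### Worst-case cost of evaluations with bounded fuel -/

section WorstCase

variable {ι : Type} [BaseTypes ι] {F : Type}

theorem Step.toVal_eq_none {P : Program ι F} {e : Expr ι F} {c : ℝ≥0} {μ : MDist (Expr ι F)}
    (h : Step P e c μ) : e.toVal = none := by
  cases h <;> rfl

theorem Terminal.of_toVal {P : Program ι F} {e : Expr ι F} {v : Val ι} (h : e.toVal = some v) :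
    Terminal P e := by
  intro c μ hs
  simp [hs.toVal_eq_none] at h

theorem Step.mass {P : Program ι F} {e : Expr ι F} {c : ℝ≥0} {μ : MDist (Expr ι F)}
    (h : Step P e c μ) : (μ.map Prod.fst).sum = 1 := by
  induction h with
  | letCtx x e₁ e₂ c μ _ ih => simpa [MDist.mapObj] using ih
  | coin p hp e₁ e₂ =>
    have : (p : ℝ≥0) ≤ 1 := by exact_mod_cast hp
    simpa using add_tsub_cancel_of_le this
  | _ => simp

/-- The expectation of a function under a multidistribution. -/
def MDist.expect {A : Type} (μ : MDist A) (h : A → ℝ≥0∞) : ℝ≥0∞ :=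
  (μ.map fun a => (a.1 : ℝ≥0∞) * h a.2).sum

/-- What a single step contributes: the expectation, or the worst case if coin tosses are read as
non-deterministic choices. -/
def Mode.aggregate {A : Type} : Mode → MDist A → (A → ℝ≥0∞) → ℝ≥0∞
  | .costed, μ, h => μ.expect h
  | .costFree, μ, h => μ.expect h
  | .costFreeNondet, μ, h => ⨆ a ∈ μ, h a.2

/-- The cost of a step that counts in the respective mode. -/
def Mode.stepCost : Mode → ℝ≥0 → ℝ≥0∞
  | .costed, c => c
  | .costFree, _ => 0
  | .costFreeNondet, _ => 0

open Classical in
/-- The supremum, over all ways to evaluate `e` for `n` steps, of the cost plus the expectation of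
`g` at the values that have been reached. Stuck expressions count as infinitely expensive. -/
def worst (P : Program ι F) (m : Mode) (g : Val ι → ℝ≥0∞) : ℕ → Expr ι F → ℝ≥0∞
  | 0, e => e.toVal.elim 0 g
  | n + 1, e => e.toVal.elim
      (if Terminal P e then ⊤ else
        ⨆ (c : ℝ≥0) (μ : MDist (Expr ι F)) (_ : Step P e c μ),
          m.stepCost c + m.aggregate μ (worst P m g n)) g

variable {P : Program ι F} {m : Mode} {g : Val ι → ℝ≥0∞} {n : ℕ} {e : Expr ι F}

theorem worst_of_toVal {v : Val ι} (h : e.toVal = some v) : worst P m g n e = g v := by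
  cases n <;> simp [worst, h]

theorem worst_zero (h : e.toVal = none) : worst P m g 0 e = 0 := by simp [worst, h]

theorem worst_stuck (h : e.toVal = none) (h' : Terminal P e) : worst P m g (n + 1) e = ⊤ := by
  simp [worst, h, h']

theorem Step.le_worst {c : ℝ≥0} {μ : MDist (Expr ι F)} (h : Step P e c μ) :
    m.stepCost c + m.aggregate μ (worst P m g n) ≤ worst P m g (n + 1) e := by
  have h' : ¬ Terminal P e := fun ht => ht c μ h
  simp only [worst, h.toVal_eq_none, Option.elim_none, h', if_false]
  exact le_iSup_of_le c (le_iSup_of_le μ (le_iSup_of_le h le_rfl))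

theorem worst_succ_le {B : ℝ≥0∞} (h : ¬ Terminal P e)
    (hB : ∀ c μ, Step P e c μ → m.stepCost c + m.aggregate μ (worst P m g n) ≤ B) :
    worst P m g (n + 1) e ≤ B := by
  have h₀ : e.toVal = none := by
    cases hv : e.toVal with
    | none => rfl
    | some v => exact absurd (Terminal.of_toVal hv) h
  simp only [worst, h₀, Option.elim_none, h, if_false]
  exact iSup_le fun c => iSup_le fun μ => iSup_le fun hs => hB c μ hs

theorem Mode.aggregate_mono {A : Type} (m : Mode) {μ : MDist A} {h h' : A → ℝ≥0∞}
    (hh : ∀ a ∈ μ, h a.2 ≤ h' a.2) : m.aggregate μ h ≤ m.aggregate μ h' := by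
  have : μ.expect h ≤ μ.expect h' := Multiset.sum_map_le_sum_map _ _ fun a ha => by
    gcongr; exact hh a ha
  cases m
  · exact this
  · exact this
  · exact iSup₂_mono hh

theorem MDist.expect_add {A : Type} (μ : MDist A) (h h' : A → ℝ≥0∞) :
    μ.expect (fun a => h a + h' a) = μ.expect h + μ.expect h' := by
  simp [MDist.expect, mul_add, Multiset.sum_map_add]

theorem MDist.expect_const_mul {A : Type} (μ : MDist A) (K : ℝ≥0∞) (h : A → ℝ≥0∞) :
    μ.expect (fun a => K * h a) = K * μ.expect h := by
  simp [MDist.expect, mul_left_comm, Multiset.sum_map_mul_left]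

theorem MDist.expect_const {A : Type} {μ : MDist A} (hμ : (μ.map Prod.fst).sum = 1) (K : ℝ≥0∞) :
    μ.expect (fun _ => K) = K := by
  have : (μ.map fun a => (a.1 : ℝ≥0∞)).sum = 1 := by
    have := congrArg (ENNReal.ofNNRealHom) hμ
    rw [map_multiset_sum, Multiset.map_map, map_one] at this
    exact this
  rw [MDist.expect, Multiset.sum_map_mul_right, this, one_mul]

theorem MDist.expect_le_iSup {A : Type} {μ : MDist A} (hμ : (μ.map Prod.fst).sum = 1)
    (h : A → ℝ≥0∞) : μ.expect h ≤ ⨆ a ∈ μ, h a.2 :=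
  (Multiset.sum_map_le_sum_map _ (fun a : ℝ≥0 × A => (a.1 : ℝ≥0∞) * ⨆ b ∈ μ, h b.2) fun a ha => by
    gcongr; exact le_iSup₂_of_le a ha le_rfl).trans_eq (MDist.expect_const hμ _)

theorem Mode.expect_le_aggregate {A : Type} (m : Mode) {μ : MDist A}
    (hμ : (μ.map Prod.fst).sum = 1) (h : A → ℝ≥0∞) : μ.expect h ≤ m.aggregate μ h := by
  cases m
  · exact le_rfl
  · exact le_rfl
  · exact MDist.expect_le_iSup hμ h

/-- Expectations are additive and are dominated by the aggregate of any mode, so `m'` is free if `m`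
is an expectation. A supremum of sums is only bounded by the sum of suprema, hence the condition on
`m'` otherwise. -/
theorem Mode.aggregate_add_le {A : Type} {m m' : Mode}
    (hm : m = .costFreeNondet → m' = .costFreeNondet) {μ : MDist A}
    (hμ : (μ.map Prod.fst).sum = 1) (h h' : A → ℝ≥0∞) (K : ℝ≥0∞) :
    m.aggregate μ (fun a => h a + K * h' a) ≤ m.aggregate μ h + K * m'.aggregate μ h' := by
  have : μ.expect (fun a => h a + K * h' a) ≤ μ.expect h + K * m'.aggregate μ h' := by
    rw [MDist.expect_add, MDist.expect_const_mul]
    gcongr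
    exact m'.expect_le_aggregate hμ h'
  cases m
  · exact this
  · exact this
  · rw [hm rfl]
    refine iSup₂_le fun a ha => add_le_add ?_ (mul_le_mul_right ?_ _)
    · exact le_iSup₂_of_le (f := fun a (_ : a ∈ μ) => h a.2) a ha le_rfl
    · exact le_iSup₂_of_le (f := fun a (_ : a ∈ μ) => h' a.2) a ha le_rfl

theorem worst_mono {g g' : Val ι → ℝ≥0∞} (hg : ∀ v, g v ≤ g' v) :
    ∀ n (e : Expr ι F), worst P m g n e ≤ worst P m g' n e := by
  intro n
  induction n with
  | zero =>
    intro e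
    cases hv : e.toVal with
    | none => simp [worst_zero hv]
    | some v => simpa [worst_of_toVal hv] using hg v
  | succ n ih =>
    intro e
    cases hv : e.toVal with
    | some v => simpa [worst_of_toVal hv] using hg v
    | none =>
      by_cases ht : Terminal P e
      · simp [worst_stuck hv ht]
      · refine worst_succ_le ht fun c μ hs => le_trans ?_ hs.le_worst
        gcongr
        exact m.aggregate_mono fun a _ => ih a.2

/-- Both summands on the right may choose their evaluations separately, which only increases them.
Used with `m' = m.free` for the factor `K` at function calls, and with the non-deterministic mode
for the mixed potentials at `let`. -/
theorem worst_add_le {m' : Mode} (hm : m = .costFreeNondet → m' = .costFreeNondet)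
    {h g g' : Val ι → ℝ≥0∞} {K : ℝ≥0∞} (hg : ∀ v, h v ≤ g v + K * g' v) :
    ∀ n (e : Expr ι F), worst P m h n e ≤ worst P m g n e + K * worst P m' g' n e := by
  intro n
  induction n with
  | zero =>
    intro e
    cases hv : e.toVal with
    | none => simp [worst_zero hv]
    | some v => simpa [worst_of_toVal hv] using hg v
  | succ n ih =>
    intro e
    cases hv : e.toVal with
    | some v => simpa [worst_of_toVal hv] using hg v
    | none =>
      by_cases ht : Terminal P e
      · simp [worst_stuck hv ht]
      · refine worst_succ_le ht fun c μ hs => ?_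
        calc m.stepCost c + m.aggregate μ (worst P m h n)
            ≤ m.stepCost c + (m.aggregate μ (worst P m g n)
                + K * m'.aggregate μ (worst P m' g' n)) := by
              gcongr
              exact (m.aggregate_mono fun a _ => ih a.2).trans
                (Mode.aggregate_add_le hm hs.mass _ _ K)
          _ ≤ (m.stepCost c + m.aggregate μ (worst P m g n))
                + K * (m'.stepCost c + m'.aggregate μ (worst P m' g' n)) := by
              rw [add_assoc]
              gcongr
              exact le_add_self
          _ ≤ _ := by gcongr <;> exact hs.le_worst

/-- Steps preserve total mass, so a constant stays the same. This is not just the previous lemma for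
the payoff `1`, whose `worst` exceeds `1` where evaluation gets stuck. -/
theorem worst_add_const_le {h g : Val ι → ℝ≥0∞} {K : ℝ≥0∞} (hg : ∀ v, h v ≤ g v + K) :
    ∀ n (e : Expr ι F), worst P m h n e ≤ worst P m g n e + K := by
  intro n
  induction n with
  | zero =>
    intro e
    cases hv : e.toVal with
    | none => simp [worst_zero hv]
    | some v => simpa [worst_of_toVal hv] using hg v
  | succ n ih =>
    intro e
    cases hv : e.toVal with
    | some v => simpa [worst_of_toVal hv] using hg v
    | none =>
      by_cases ht : Terminal P e
      · simp [worst_stuck hv ht]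
      · refine worst_succ_le ht fun c μ hs => ?_
        have h₁ : m.aggregate μ (fun a => worst P m g n a + K)
            ≤ m.aggregate μ (worst P m g n) + K := by
          have := Mode.aggregate_add_le (m := m) (m' := .costFreeNondet) (fun _ => rfl) hs.mass
            (worst P m g n) (fun _ => 1) K
          simp only [mul_one] at this
          refine this.trans ?_
          gcongr
          refine (mul_le_mul_right (iSup₂_le fun a _ => le_rfl) K).trans_eq (mul_one K)
        calc m.stepCost c + m.aggregate μ (worst P m h n)
            ≤ m.stepCost c + (m.aggregate μ (worst P m g n) + K) := by
              gcongr
              exact (m.aggregate_mono fun a _ => ih a.2).trans h₁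
          _ = (m.stepCost c + m.aggregate μ (worst P m g n)) + K := by rw [add_assoc]
          _ ≤ _ := by gcongr; exact hs.le_worst

/-- In the worst case over coin tosses, a finite bound holds for every value that is reached. -/
theorem worst_nondet_le_of_imp {h : Val ι → ℝ≥0∞} {B B' : ℝ≥0∞} (hB : B ≠ ⊤)
    (hg : ∀ v, g v ≤ B → h v ≤ B') : ∀ n (e : Expr ι F),
    worst P .costFreeNondet g n e ≤ B → worst P .costFreeNondet h n e ≤ B' := by
  intro n
  induction n with
  | zero =>
    intro e he
    cases hv : e.toVal with
    | none => simp [worst_zero hv]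
    | some v =>
      rw [worst_of_toVal hv] at he ⊢
      exact hg v he
  | succ n ih =>
    intro e he
    cases hv : e.toVal with
    | some v =>
      rw [worst_of_toVal hv] at he ⊢
      exact hg v he
    | none =>
      by_cases ht : Terminal P e
      · rw [worst_stuck hv ht] at he
        exact absurd (top_le_iff.mp he) hB
      · refine worst_succ_le ht fun c μ hs => ?_
        have h₁ := (hs.le_worst (m := .costFreeNondet) (g := g) (n := n)).trans he
        simp only [Mode.stepCost, Mode.aggregate, zero_add] at h₁ ⊢
        -- A bound on a supremum holds for each member separately, so the hypothesis can be handed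
        -- on to every reduct; a bound on an expectation could not.
        exact iSup₂_le fun a ha => ih a.2
          ((le_iSup₂_of_le (f := fun a (_ : a ∈ μ) => worst P .costFreeNondet g n a.2)
            a ha le_rfl).trans h₁)

theorem Mode.aggregate_mapObj {A B : Type} (m : Mode) (μ : MDist A) (k : A → B) (h : B → ℝ≥0∞) :
    m.aggregate (μ.mapObj k) h = m.aggregate μ fun a => h (k a) := by
  cases m
  · simp [Mode.aggregate, MDist.expect, MDist.mapObj]
  · simp [Mode.aggregate, MDist.expect, MDist.mapObj]
  · simp only [Mode.aggregate, MDist.mapObj, Multiset.mem_map]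
    apply le_antisymm
    · refine iSup₂_le ?_
      rintro _ ⟨a, ha, rfl⟩
      exact le_iSup₂_of_le (f := fun a (_ : a ∈ μ) => h (k a.2)) a ha le_rfl
    · refine iSup₂_le fun a ha => ?_
      exact le_iSup₂_of_le (f := fun b (_ : ∃ a ∈ μ, (a.1, k a.2) = b) => h b.2)
        (a.1, k a.2) ⟨a, ha, rfl⟩ le_rfl

theorem Mode.aggregate_singleton {A : Type} (m : Mode) (a : A) (h : A → ℝ≥0∞) :
    m.aggregate {(1, a)} h = h a := by
  cases m <;> simp [Mode.aggregate, MDist.expect]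

/-- An evaluation of `let` first evaluates `e₁` in context and then the body with whatever fuel is
left. Since this remainder depends on the evaluation, `h` has to bound the body for all fuels up to
`n`. -/
theorem worst_letIn_le {x : Var} {e₂ : Expr ι F} {h : Val ι → ℝ≥0∞} : ∀ n (e₁ : Expr ι F),
    (∀ k ≤ n, ∀ v, worst P m g k (e₂.subst (bindings [x] [v])) ≤ h v) →
    worst P m g n (.letIn x e₁ e₂) ≤ worst P m h n e₁ := by
  intro n
  induction n with
  | zero => intro e₁ _; simp [worst_zero (e := .letIn x e₁ e₂) rfl]
  | succ n ih =>
    intro e₁ hn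
    cases hv : e₁.toVal with
    | some v =>
      have ht : ¬ Terminal P (.letIn x e₁ e₂) := fun ht => ht _ _ (.letVal x e₁ e₂ v hv)
      refine worst_succ_le ht fun c μ hs => ?_
      cases hs with
      | letVal _ _ _ v' hv' =>
        rw [hv, Option.some.injEq] at hv'
        subst hv'
        -- Entering the body takes one unit of fuel; on the right, `worst` at a value does not
        -- depend on the fuel.
        rw [worst_of_toVal hv, Mode.aggregate_singleton]
        have := hn n n.le_succ v
        cases m <;> simpa [Mode.stepCost] using this
      | letCtx _ _ _ _ μ hs => simp [hs.toVal_eq_none] at hv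
    | none =>
      by_cases ht₁ : Terminal P e₁
      -- If `e₁` is stuck, the right-hand side is infinite.
      · simp [worst_stuck hv ht₁]
      have ht : ¬ Terminal P (.letIn x e₁ e₂) := by
        simp only [Terminal, not_forall, not_not] at ht₁
        obtain ⟨c, μ, hs⟩ := ht₁
        exact fun ht => ht _ _ (.letCtx x e₁ e₂ c μ hs)
      refine worst_succ_le ht fun c μ hs => ?_
      cases hs with
      | letVal _ _ _ v' hv' => simp [hv] at hv'
      | letCtx _ _ _ _ μ hs =>
        rw [Mode.aggregate_mapObj]
        refine le_trans ?_ hs.le_worst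
        gcongr
        exact m.aggregate_mono fun a _ => ih a.2 fun k hk => hn k (hk.trans n.le_succ)

end WorstCase

/-! ### Potential under the operations on annotations -/

section Potential

variable {X Y ι : Type} [BaseTypes ι]

/-- The number of which an index denotes the logarithm. -/
def logArg (σ : X → Val ι) (i : (X →₀ ℕ) × ℤ) : ℝ :=
  (i.1.sum fun x n => (n : ℝ) * ((σ x).size : ℝ)) + (i.2 : ℝ)

/-- The logarithmic part of a potential. -/
def logPotential (σ : X → Val ι) (L : ((X →₀ ℕ) × ℤ) →₀ ℝ≥0) : ℝ :=
  L.sum fun i q => (q : ℝ) * Real.logb 2 (logArg σ i)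

/-- The rank part of a potential. -/
def rankPotential (σ : X → Val ι) (R : X →₀ ℝ≥0) : ℝ := R.sum fun x q => (q : ℝ) * (σ x).rank

theorem sum_size_congr {a : X →₀ ℕ} {σ τ : X → Val ι}
    (h : ∀ x ∈ a.support, (σ x).size = (τ x).size) :
    (a.sum fun x n => (n : ℝ) * ((σ x).size : ℝ)) =
      a.sum fun x n => (n : ℝ) * ((τ x).size : ℝ) :=
  Finset.sum_congr rfl fun x hx => by simp only [h x hx]

theorem rankPotential_congr {R : X →₀ ℝ≥0} {σ τ : X → Val ι}
    (h : ∀ x ∈ R.support, (σ x).rank = (τ x).rank) : rankPotential σ R = rankPotential τ R :=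
  Finset.sum_congr rfl fun x hx => by simp only [h x hx]

theorem Ann.potential_eq (Q : Ann X) (σ : X → Val ι) :
    Q.potential σ = rankPotential σ Q.rk + logPotential σ Q.lg := rfl

theorem logPotential_add (σ : X → Val ι) (L M : ((X →₀ ℕ) × ℤ) →₀ ℝ≥0) :
    logPotential σ (L + M) = logPotential σ L + logPotential σ M :=
  Finsupp.sum_add_index' (by simp) (by intros; push_cast; ring)

theorem rankPotential_add (σ : X → Val ι) (L M : X →₀ ℝ≥0) :
    rankPotential σ (L + M) = rankPotential σ L + rankPotential σ M :=
  Finsupp.sum_add_index' (by simp) (by intros; push_cast; ring)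

theorem logPotential_single (σ : X → Val ι) (i : (X →₀ ℕ) × ℤ) (q : ℝ≥0) :
    logPotential σ (Finsupp.single i q) = q * Real.logb 2 (logArg σ i) :=
  Finsupp.sum_single_index (by simp)

theorem rankPotential_single (σ : X → Val ι) (x : X) (q : ℝ≥0) :
    rankPotential σ (Finsupp.single x q) = q * (σ x).rank :=
  Finsupp.sum_single_index (by simp)

theorem logPotential_smul (σ : X → Val ι) (K : ℝ≥0) (L : ((X →₀ ℕ) × ℤ) →₀ ℝ≥0) :
    logPotential σ (K • L) = K * logPotential σ L := by
  rw [logPotential, Finsupp.sum_smul_index' (by simp), logPotential, Finsupp.mul_sum]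
  simp [mul_assoc]

theorem rankPotential_smul (σ : X → Val ι) (K : ℝ≥0) (L : X →₀ ℝ≥0) :
    rankPotential σ (K • L) = K * rankPotential σ L := by
  rw [rankPotential, Finsupp.sum_smul_index' (by simp), rankPotential, Finsupp.mul_sum]
  simp [mul_assoc]

theorem logPotential_mapDomain (σ : X → Val ι) (f : (Y →₀ ℕ) × ℤ → (X →₀ ℕ) × ℤ)
    (L : ((Y →₀ ℕ) × ℤ) →₀ ℝ≥0) :
    logPotential σ (L.mapDomain f) = L.sum fun i q => (q : ℝ) * Real.logb 2 (logArg σ (f i)) :=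
  Finsupp.sum_mapDomain_index (by simp) (by intros; push_cast; ring)

theorem logPotential_mapDomain_of_eq {σ : X → Val ι} {τ : Y → Val ι}
    {f : (Y →₀ ℕ) × ℤ → (X →₀ ℕ) × ℤ} (h : ∀ i, logArg σ (f i) = logArg τ i)
    (L : ((Y →₀ ℕ) × ℤ) →₀ ℝ≥0) : logPotential σ (L.mapDomain f) = logPotential τ L := by
  rw [logPotential_mapDomain, logPotential]
  simp [h]

theorem Ann.potential_add (Q R : Ann X) (σ : X → Val ι) :
    (Q + R).potential σ = Q.potential σ + R.potential σ := by
  simp only [Ann.potential_eq, Ann.rk, Ann.lg, Prod.fst_add, Prod.snd_add, rankPotential_add,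
    logPotential_add]
  ring

theorem Ann.potential_smul (K : ℝ≥0) (Q : Ann X) (σ : X → Val ι) :
    (K • Q).potential σ = K * Q.potential σ := by
  simp only [Ann.potential_eq, Ann.rk, Ann.lg, Prod.smul_fst, Prod.smul_snd, rankPotential_smul,
    logPotential_smul]
  ring

theorem Ann.potential_zero (σ : X → Val ι) : (0 : Ann X).potential σ = 0 := by
  simp [Ann.potential]

theorem Ann.potential_sum {κ : Type} (I : Finset κ) (A : κ → Ann X) (σ : X → Val ι) :
    (∑ k ∈ I, A k).potential σ = ∑ k ∈ I, (A k).potential σ := by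
  classical
  induction I using Finset.induction_on with
  | empty => simp [Ann.potential_zero]
  | insert k I hk ih => rw [Finset.sum_insert hk, Finset.sum_insert hk, Ann.potential_add, ih]

theorem Ann.potential_const (K : ℝ≥0) (σ : X → Val ι) : (Ann.const K).potential σ = K := by
  simp only [Ann.potential_eq, Ann.const, Ann.rk, Ann.lg, logPotential_single]
  simp [rankPotential, logArg]

theorem Ann.potential_map (g : X → Y) (Q : Ann X) (σ : Y → Val ι) :
    (Q.map g).potential σ = Q.potential fun x => σ (g x) := by
  rw [Ann.potential_eq, Ann.potential_eq]
  congr 1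
  · exact Finsupp.sum_mapDomain_index (by simp) (by intros; push_cast; ring)
  · refine logPotential_mapDomain_of_eq (fun i => ?_) _
    simp only [logArg]
    rw [Finsupp.sum_mapDomain_index (by simp) (by intros; push_cast; ring)]

theorem Ann.potential_congr {Q : Ann X} {s : Set X} (hQ : Q.For s) {σ τ : X → Val ι}
    (h : ∀ x ∈ s, (σ x).size = (τ x).size ∧ (σ x).rank = (τ x).rank) :
    Q.potential σ = Q.potential τ := by
  rw [Ann.potential_eq, Ann.potential_eq]
  congr 1
  · exact rankPotential_congr fun x hx => (h x (hQ.1 x hx)).2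
  · refine Finsupp.sum_congr fun i hi => ?_
    rw [logArg, logArg, sum_size_congr fun x hx => (h x ((hQ.2 i hi).1 x hx)).1]

theorem Ann.potential_congr_of_eqOn {Q : Ann X} {s : Set X} (hQ : Q.For s) {σ τ : X → Val ι}
    (h : ∀ x ∈ s, σ x = τ x) : Q.potential σ = Q.potential τ :=
  Ann.potential_congr hQ fun x hx => by simp [h x hx]

variable [DecidableEq X]

theorem logArg_atLeaf (i : (X →₀ ℕ) × ℤ) (x : X) (σ : X → Val ι) :
    logArg σ (i.1.erase x, (i.1 x : ℤ) + i.2) = logArg (Function.update σ x .leaf) i := by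
  obtain ⟨a, b⟩ := i
  conv_rhs => rw [← Finsupp.single_add_erase x a]
  simp only [logArg]
  rw [Finsupp.sum_add_index' (by simp) (by intros; push_cast; ring),
    Finsupp.sum_single_index (by simp)]
  rw [sum_size_congr (τ := Function.update σ x .leaf) fun u hu => by
    have : u ≠ x := by rintro rfl; simp at hu
    simp [this]]
  simp [Val.size]
  ring

/-- A leaf has size one, which moves its multiplicity into the constant of the logarithm, and rank
one, which turns its rank coefficient into constant potential. -/
theorem Ann.potential_atLeaf (Q : Ann X) (x : X) (σ : X → Val ι) :
    (Q.atLeaf x).potential σ = Q.potential (Function.update σ x .leaf) := by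
  rw [Ann.atLeaf, Ann.potential_add, Ann.potential_const, Ann.potential_eq, Ann.potential_eq]
  simp only [Ann.rk, Ann.lg]
  rw [logPotential_mapDomain_of_eq (fun i => logArg_atLeaf i x σ)]
  conv_rhs => rw [← Finsupp.single_add_erase x Q.1, rankPotential_add, rankPotential_single]
  rw [rankPotential_congr (τ := Function.update σ x .leaf) fun u hu => by
    have : u ≠ x := by rintro rfl; simp at hu
    simp [this]]
  simp [Val.rank]
  ring

theorem logArg_atNode (i : (X →₀ ℕ) × ℤ) (x y z : X) (σ : X → Val ι) (d : Val ι) :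
    logArg σ (i.1.erase x + Finsupp.single y (i.1 x) + Finsupp.single z (i.1 x), i.2) =
      logArg (Function.update σ x (.node (σ y) d (σ z))) i := by
  obtain ⟨a, b⟩ := i
  conv_rhs => rw [← Finsupp.single_add_erase x a]
  simp only [logArg]
  iterate 3 rw [Finsupp.sum_add_index' (by simp) (by intros; push_cast; ring)]
  iterate 3 rw [Finsupp.sum_single_index (by simp)]
  rw [sum_size_congr (τ := Function.update σ x (.node (σ y) d (σ z))) fun u hu => by
    have : u ≠ x := by rintro rfl; simp at hu
    simp [this]]
  simp [Val.size]
  ring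

/-- The two added logarithms are those in the recursion of the rank. No distinctness of `x`, `y`,
`z` is needed, so the same identity serves for destructing a node and, with `y = x`, for
constructing one. -/
theorem Ann.potential_atNode (Q : Ann X) (x y z : X) (σ : X → Val ι) (d : Val ι) :
    (Q.atNode x y z).potential σ =
      Q.potential (Function.update σ x (.node (σ y) d (σ z))) := by
  rw [Ann.atNode, Ann.potential_eq, Ann.potential_eq]
  simp only [Ann.rk, Ann.lg, rankPotential_add, logPotential_add, rankPotential_single,
    logPotential_single]
  rw [logPotential_mapDomain_of_eq (fun i => logArg_atNode i x y z σ d)]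
  conv_rhs => rw [← Finsupp.single_add_erase x Q.1, rankPotential_add, rankPotential_single]
  rw [rankPotential_congr (τ := Function.update σ x (.node (σ y) d (σ z))) fun u hu => by
    have : u ≠ x := by rintro rfl; simp at hu
    simp [this]]
  simp [Val.rank, logArg]
  ring

end Potential

/-! ### Sizes and ranks of typed values; non-negativity of potentials -/

section Values

variable {ι : Type} [BaseTypes ι]

theorem Val.HasType.one_le_size_of_tree {v : Val ι} {b : Base ι} (h : v.HasType (.tree b)) :
    1 ≤ v.size ∧ 0 ≤ v.rank := by
  generalize hα : Ty.tree b = α at h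
  induction h with
  | leaf => simp [Val.size, Val.rank]
  | node _ _ _ ih₁ _ ih₃ =>
    obtain ⟨h₁, h₂⟩ := ih₁ hα
    obtain ⟨h₃, h₄⟩ := ih₃ hα
    refine ⟨by simp only [Val.size]; omega, ?_⟩
    have := Real.logb_nonneg (b := 2) one_lt_two (Nat.one_le_cast.mpr h₁)
    have := Real.logb_nonneg (b := 2) one_lt_two (Nat.one_le_cast.mpr h₃)
    simp only [Val.rank]
    positivity
  | _ => cases hα

/-- The case without trees is what makes the sums in the size and rank of a pair those of its unique
tree. -/
theorem Val.HasType.size_rank {v : Val ι} {α : Ty ι} (h : v.HasType α) :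
    (α.numTrees = 0 → v.size = 0 ∧ v.rank = 0) ∧
    (α.numTrees = 1 → 1 ≤ v.size ∧ 0 ≤ v.rank) := by
  induction h with
  | const b x => simp [Val.size, Val.rank, Ty.numTrees]
  | leaf b => simp [Val.size, Val.rank, Ty.numTrees]
  | node h₁ h₂ h₃ => simpa [Ty.numTrees] using (Val.HasType.node h₁ h₂ h₃).one_le_size_of_tree
  | @pair α β v w _ _ ih₁ ih₂ =>
    simp only [Val.size, Val.rank, Ty.numTrees]
    refine ⟨fun h => ?_, fun h => ?_⟩
    · have := ih₁.1 (by omega)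
      have := ih₂.1 (by omega)
      simp_all
    · rcases (by omega : α.numTrees = 1 ∧ β.numTrees = 0 ∨ α.numTrees = 0 ∧ β.numTrees = 1) with
        h' | h'
      · have := ih₁.2 h'.1
        have := ih₂.1 h'.2
        simp_all
      · have := ih₁.1 h'.1
        have := ih₂.2 h'.2
        simp_all

theorem Val.HasType.size_rank_pair {v w : Val ι} {α β : Ty ι} (hv : v.HasType α)
    (hw : w.HasType β) (h : (Ty.prod α β).numTrees = 1) :
    ((if α.numTrees = 1 then v else w).size = (Val.pair v w).size) ∧
    ((if α.numTrees = 1 then v else w).rank = (Val.pair v w).rank) := by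
  simp only [Ty.numTrees] at h
  split_ifs with hα
  · have := hw.size_rank.1 (by omega)
    simp [Val.size, Val.rank, this]
  · have := hv.size_rank.1 (by omega)
    simp [Val.size, Val.rank, this]

variable {X : Type}

theorem idxSum_add (a b : X →₀ ℕ) : idxSum (a + b) = idxSum a + idxSum b :=
  Finsupp.sum_add_index' (by simp) (by simp)

theorem idxSum_single (x : X) (n : ℕ) : idxSum (Finsupp.single x n) = n :=
  Finsupp.sum_single_index (by simp)

theorem idxSum_zero : idxSum (0 : X →₀ ℕ) = 0 := by simp [idxSum]

theorem idxSum_mapDomain {Y : Type} (g : X → Y) (a : X →₀ ℕ) :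
    idxSum (a.mapDomain g) = idxSum a :=
  Finsupp.sum_mapDomain_index (by simp) (by simp)

theorem idxSum_erase [DecidableEq X] (a : X →₀ ℕ) (x : X) :
    idxSum (a.erase x) + a x = idxSum a := by
  conv_rhs => rw [← Finsupp.single_add_erase x a, idxSum_add, idxSum_single]
  ring

theorem idxSum_le_sum_size {a : X →₀ ℕ} {σ : X → Val ι} (h : ∀ x ∈ a.support, 1 ≤ (σ x).size) :
    (idxSum a : ℝ) ≤ a.sum fun x n => (n : ℝ) * ((σ x).size : ℝ) := by
  rw [idxSum, Finsupp.sum, Finsupp.sum]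
  push_cast
  refine Finset.sum_le_sum fun x hx => ?_
  have : (1 : ℝ) ≤ (σ x).size := by exact_mod_cast h x hx
  nlinarith [Nat.cast_nonneg (α := ℝ) (a x)]

theorem one_le_logArg {i : (X →₀ ℕ) × ℤ} {σ : X → Val ι} (h : ∀ x ∈ i.1.support, 1 ≤ (σ x).size)
    (hi : 1 ≤ idxSum i.1 + i.2) : 1 ≤ logArg σ i := by
  have : (1 : ℝ) ≤ idxSum i.1 + i.2 := by exact_mod_cast hi
  have := idxSum_le_sum_size h
  rw [logArg]
  linarith

theorem logPotential_nonneg {L : ((X →₀ ℕ) × ℤ) →₀ ℝ≥0} {σ : X → Val ι}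
    (h : ∀ i ∈ L.support, 1 ≤ logArg σ i) : 0 ≤ logPotential σ L :=
  Finset.sum_nonneg fun i hi =>
    mul_nonneg (NNReal.coe_nonneg _) (Real.logb_nonneg one_lt_two (h i hi))

/-- All trees in `s` are proper trees. -/
def IsTreeOn (s : Set X) (σ : X → Val ι) : Prop := ∀ x ∈ s, 1 ≤ (σ x).size ∧ 0 ≤ (σ x).rank

theorem Ann.For.one_le_logArg {Q : Ann X} {s : Set X} (hQ : Q.For s) {σ : X → Val ι}
    (hσ : IsTreeOn s σ) {i : (X →₀ ℕ) × ℤ} (hi : i ∈ Q.lg.support) : 1 ≤ logArg σ i :=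
  _root_.one_le_logArg (fun x hx => (hσ x ((hQ.2 i hi).1 x hx)).1) (hQ.2 i hi).2

theorem Ann.For.potential_nonneg {Q : Ann X} {s : Set X} (hQ : Q.For s) {σ : X → Val ι}
    (hσ : IsTreeOn s σ) : 0 ≤ Q.potential σ :=
  add_nonneg (Finset.sum_nonneg fun x hx => mul_nonneg (NNReal.coe_nonneg _) (hσ x (hQ.1 x hx)).2)
    (logPotential_nonneg fun _ hi => hQ.one_le_logArg hσ hi)

/-- The dropped terms are non-negative: ranks of proper trees are, and the logarithms are taken of
numbers at least one. -/
theorem Ann.For.potential_drop_le [DecidableEq X] {Q : Ann X} {s : Set X} (hQ : Q.For s)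
    {σ : X → Val ι} (hσ : IsTreeOn s σ) (x : X) : (Q.drop x).potential σ ≤ Q.potential σ := by
  rw [Ann.potential_eq, Ann.potential_eq]
  refine add_le_add ?_ ?_
  · conv_rhs => rw [← Finsupp.single_add_erase x Q.rk, rankPotential_add, rankPotential_single]
    refine le_add_of_nonneg_left ?_
    by_cases hx : x ∈ Q.rk.support
    · exact mul_nonneg (NNReal.coe_nonneg _) (hσ x (hQ.1 x hx)).2
    · simp [Finsupp.notMem_support_iff.mp hx]
  · conv_rhs => rw [← Finsupp.filter_add_filter_not Q.lg (fun i => i.1 x = 0),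
      logPotential_add]
    refine le_add_of_nonneg_right (logPotential_nonneg fun i hi => hQ.one_le_logArg hσ ?_)
    rw [Finsupp.support_filter] at hi
    exact (Finset.mem_filter.mp hi).1

theorem Ctx.Respects.isTreeOn {Γ : Ctx ι} {σ : Var → Val ι} (h : Γ.Respects σ) :
    IsTreeOn Γ.treeVars σ := by
  rintro x ⟨α, hx, hα⟩
  exact (h x α hx).size_rank.2 hα

theorem Val.HasType.isTreeOn {v : Val ι} {α : Ty ι} (h : v.HasType α) :
    IsTreeOn α.slot (fun _ => v) := fun _ hα => h.size_rank.2 hα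

end Values

/-! ### Mixed logarithmic potentials at let-expressions -/

section Cross

/-- Adding the same number to all arguments preserves a weighted inequality of logarithms if all
weights on the larger side are at least the weight on the smaller side. -/
theorem log_shift {κ : Type} (s : Finset κ) (q a : κ → ℝ) {w b B : ℝ} (hw : 0 < w) (hb : 1 ≤ b)
    (hB : 0 ≤ B) (hs : s.Nonempty) (hq : ∀ i ∈ s, w ≤ q i) (ha : ∀ i ∈ s, 1 ≤ a i)
    (h : w * Real.logb 2 b ≤ ∑ i ∈ s, q i * Real.logb 2 (a i)) :
    w * Real.logb 2 (b + B) ≤ ∑ i ∈ s, q i * Real.logb 2 (a i + B) := by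
  classical
  obtain ⟨j, hj⟩ := hs
  -- After division by `w` the exponents are at least one, and the hypothesis reads `b ≤ ∏ aᵢ ^ rᵢ`.
  set r : κ → ℝ := fun i => q i / w with hr
  have hr1 : ∀ i ∈ s, 1 ≤ r i := fun i hi => (one_le_div hw).mpr (hq i hi)
  have hrq : ∀ i, q i = w * r i := fun i => by simp only [hr]; field_simp
  simp only [hrq, mul_assoc, ← Finset.mul_sum] at h ⊢
  have h' := le_of_mul_le_mul_left h hw
  refine mul_le_mul_of_nonneg_left ?_ hw.le
  have hlog : ∀ c : ℝ, (∀ i ∈ s, 1 ≤ a i + c) → ∑ i ∈ s, r i * Real.logb 2 (a i + c) =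
      Real.logb 2 (∏ i ∈ s, (a i + c) ^ r i) := by
    intro c hc
    rw [Real.logb_prod _ _ fun i hi => (Real.rpow_pos_of_pos (by linarith [hc i hi]) _).ne']
    exact Finset.sum_congr rfl fun i hi => by
      rw [Real.logb_rpow_eq_mul_logb_of_pos (by linarith [hc i hi])]
  have h0 := hlog 0 (by simpa using ha)
  simp only [add_zero] at h0
  rw [h0] at h'
  have hpos : ∀ i ∈ s, 0 < a i ^ r i := fun i hi => Real.rpow_pos_of_pos (by linarith [ha i hi]) _
  have hprod := (Real.logb_le_logb one_lt_two (by linarith) (Finset.prod_pos hpos)).mp h'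
  rw [hlog B fun i hi => by linarith [ha i hi]]
  refine (Real.logb_le_logb one_lt_two (by linarith)
    (Finset.prod_pos fun i hi => Real.rpow_pos_of_pos (by linarith [ha i hi]) _)).mpr ?_
  -- A single factor, that of `j`, absorbs the summand `B`; for the others it is enough that they do
  -- not decrease and have product `Y ≥ 1`.
  rw [← Finset.mul_prod_erase s _ hj] at hprod ⊢
  set Y := ∏ i ∈ s.erase j, a i ^ r i
  have hY : 1 ≤ Y := Finset.prod_induction _ (1 ≤ ·) (fun _ _ => one_le_mul_of_one_le_of_one_le)
      le_rfl fun i hi => by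
    have hi := Finset.mem_of_mem_erase hi
    exact Real.one_le_rpow (ha i hi) (by linarith [hr1 i hi])
  have hY' : Y ≤ ∏ i ∈ s.erase j, (a i + B) ^ r i :=
    Finset.prod_le_prod (fun i hi => (hpos i (Finset.mem_of_mem_erase hi)).le) fun i hi => by
      have hi := Finset.mem_of_mem_erase hi
      exact Real.rpow_le_rpow (by linarith [ha i hi]) (by linarith) (by linarith [hr1 i hi])
  -- Bernoulli's inequality for `(1 + B / a j) ^ r j`, after factoring out `a j ^ r j`, which is at
  -- least `a j`.
  have hj1 : a j ^ r j + B ≤ (a j + B) ^ r j := by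
    have h1 : 1 ≤ a j := ha j hj
    have h2 : a j ≤ a j ^ r j := Real.self_le_rpow_of_one_le h1 (hr1 j hj)
    have h3 : 1 + r j * (B / a j) ≤ (1 + B / a j) ^ r j :=
      one_add_mul_self_le_rpow_one_add (by have : 0 ≤ B / a j := by positivity
                                           linarith) (hr1 j hj)
    have h4 : (a j + B) ^ r j = a j ^ r j * (1 + B / a j) ^ r j := by
      rw [← Real.mul_rpow (by linarith) (by positivity)]
      congr 1
      field_simp
    have h5 : B / a j ≤ r j * (B / a j) := le_mul_of_one_le_left (by positivity) (hr1 j hj)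
    have h6 : B ≤ a j ^ r j * (B / a j) := by
      calc B = a j * (B / a j) := by field_simp
        _ ≤ _ := by gcongr
    rw [h4]
    calc a j ^ r j + B ≤ a j ^ r j * (1 + B / a j) := by linarith
      _ ≤ _ := by gcongr; linarith
  have hx : 0 < a j ^ r j := hpos j hj
  calc b + B ≤ a j ^ r j * Y + B * Y := by nlinarith
    _ = (a j ^ r j + B) * Y := by ring
    _ ≤ _ := mul_le_mul hj1 hY' (by linarith) (by linarith)

variable {ι : Type} [BaseTypes ι]

/-- The mixed arguments are the arguments of the auxiliary judgement plus one and the same number `B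
= ∑ b_y |y| - max (-e) 0`. It is non-negative by the condition `0 ≤ ∑ b_y + e`, since every `|y|` is
at least one. So `log_shift` applies, and its conditions on weights are those in `CrossOK`. -/
theorem CrossOK.potential_le {Δ : Ctx ι} {k : CrossIdx} {A : Ann Var} {w : ℝ≥0} {s : Set Var}
    (hk : CrossOK Δ k A w) (hA : A.For s) {σ : Var → Val ι} (hs : IsTreeOn s σ)
    (hΔ : IsTreeOn Δ.treeVars σ) {v : Val ι} (hv : 1 ≤ v.size) {x : Var} (hx : Δ x = none)
    (h : (crossRes k w).potential (fun _ => v) ≤ A.potential σ) :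
    (crossBody x k w).potential (Function.update σ x v) ≤ (crossTotal k A).potential σ := by
  obtain ⟨-, hsup, hd, h1, h0, hrk, -, hsum, hle⟩ := hk
  obtain ⟨b, d, e⟩ := k
  simp only at *
  have hpot : A.potential σ = ∑ i ∈ A.lg.support, (A.lg i : ℝ) * Real.logb 2 (logArg σ i) := by
    rw [Ann.potential_eq, hrk]; simp [rankPotential, logPotential, Finsupp.sum]
  have hsize : ∀ x ∈ b.support, 1 ≤ (σ x).size := fun x hx => (hΔ x (hsup x hx)).1
  set N : ℝ := b.sum fun x n => (n : ℝ) * ((σ x).size : ℝ) with hN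
  have hNb : (idxSum b : ℝ) ≤ N := idxSum_le_sum_size hsize
  have h0' : (0 : ℝ) ≤ idxSum b + e := by exact_mod_cast h0
  have hb0 : (0 : ℝ) ≤ idxSum b := by
    have : 0 ≤ idxSum b := Finset.sum_nonneg fun _ _ => by positivity
    exact_mod_cast this
  have htot : (crossTotal (b, d, e) A).potential σ =
      ∑ i ∈ A.lg.support, (A.lg i : ℝ) *
        Real.logb 2 (logArg σ i + (N - (max (-e) 0 : ℤ))) := by
    rw [Ann.potential_eq]
    simp only [crossTotal, Ann.rk, Ann.lg, logPotential_mapDomain]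
    simp only [rankPotential, Finsupp.sum_zero_index, zero_add]
    refine Finset.sum_congr rfl fun i _ => ?_
    beta_reduce
    congr 2
    simp only [logArg]
    rw [Finsupp.sum_add_index' (by simp) (by intros; push_cast; ring), hN]
    push_cast
    ring
  have hbody : (crossBody x (b, d, e) w).potential (Function.update σ x v) =
      w * Real.logb 2 (((d : ℝ) * v.size + (max e 0 : ℤ)) + (N - (max (-e) 0 : ℤ))) := by
    rw [Ann.potential_eq]
    simp only [crossBody, Ann.rk, Ann.lg, logPotential_single]
    simp only [rankPotential, Finsupp.sum_zero_index, zero_add]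
    congr 2
    simp only [logArg]
    rw [Finsupp.sum_add_index' (by simp) (by intros; push_cast; ring),
      Finsupp.sum_single_index (by simp)]
    have : ∀ y ∈ b.support, (Function.update σ x v y).size = (σ y).size := by
      intro y hy
      have : y ≠ x := by
        rintro rfl
        obtain ⟨α, hα, -⟩ := hsup y hy
        simp [hx] at hα
      simp [this]
    rw [sum_size_congr this, ← hN]
    -- The positive part of `e` stays with `x`, the negative part goes into the shift; this keeps
    -- the argument of the auxiliary logarithm at least one.
    have he : (e : ℝ) = (max e 0 : ℤ) - (max (-e) 0 : ℤ) := by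
      have : e = max e 0 - max (-e) 0 := by omega
      exact_mod_cast this
    simp only [Function.update_self]
    linarith
  have hres : (crossRes (b, d, e) w).potential (fun _ => v) =
      w * Real.logb 2 ((d : ℝ) * v.size + (max e 0 : ℤ)) := by
    rw [Ann.potential_eq]
    simp only [crossRes, Ann.rk, Ann.lg, logPotential_single]
    simp only [rankPotential, Finsupp.sum_zero_index, zero_add]
    simp [logArg]
  rw [hres, hpot] at h
  rw [hbody, htot]
  -- For `w = 0` the auxiliary annotation may be empty, so that there is no factor to absorb the
  -- shift; the left-hand side is then zero.
  rcases eq_or_ne w 0 with rfl | hw0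
  · have hBnn : (0 : ℝ) ≤ N - (max (-e) 0 : ℤ) := by
      rcases le_total (-e) 0 with h' | h'
      · rw [max_eq_right h']; push_cast; linarith
      · rw [max_eq_left h']; push_cast; linarith
    simp only [NNReal.coe_zero, zero_mul]
    refine Finset.sum_nonneg fun i hi => mul_nonneg (NNReal.coe_nonneg _)
      (Real.logb_nonneg one_lt_two ?_)
    linarith [hA.one_le_logArg hs hi]
  · have hBnn : (0 : ℝ) ≤ N - (max (-e) 0 : ℤ) := by
      rcases le_total (-e) 0 with h' | h'
      · rw [max_eq_right h']; push_cast; linarith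
      · rw [max_eq_left h']; push_cast; linarith
    refine log_shift A.lg.support (fun i => (A.lg i : ℝ)) (logArg σ) ?_ ?_ hBnn ?_ ?_ ?_ h
    · exact_mod_cast pos_iff_ne_zero.mpr hw0
    · have h2 : (1 : ℝ) ≤ d * v.size := by
        have : 1 ≤ d * v.size := Nat.one_le_iff_ne_zero.mpr (by positivity)
        exact_mod_cast this
      have h3 : (0 : ℝ) ≤ (max e 0 : ℤ) := by exact_mod_cast le_max_right e 0
      linarith
    · by_contra hne
      rw [Finset.not_nonempty_iff_eq_empty] at hne
      rw [Finsupp.sum, hne, Finset.sum_empty] at hsum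
      exact hw0 (le_antisymm hsum zero_le)
    · intro i hi
      exact_mod_cast hle i (Finsupp.mem_support_iff.mp hi)
    · exact fun i hi => hA.one_le_logArg hs hi

end Cross

/-! ### Contexts and the substitutions that respect them -/

section Contexts

theorem List.lookup_zip_eq_some_iff {A : Type} {x : Var} {a : A} : ∀ {xs : List Var} {as : List A},
    xs.Nodup → ((xs.zip as).lookup x = some a ↔ ∃ i : ℕ, xs[i]? = some x ∧ as[i]? = some a) := by
  intro xs
  induction xs with
  | nil => simp
  | cons y xs ih =>
    intro as hxs
    rw [List.nodup_cons] at hxs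
    cases as with
    | nil => simp
    | cons b as =>
      rw [List.zip_cons_cons, List.lookup_cons]
      by_cases hxy : x = y
      · subst hxy
        simp only [BEq.rfl]
        constructor
        · intro h; exact ⟨0, by simpa using h⟩
        · rintro ⟨i, hi, hi'⟩
          cases i with
          | zero => simpa using hi'
          | succ i => exact absurd (List.mem_of_getElem? (by simpa using hi)) hxs.1
      · simp only [beq_eq_false_iff_ne.mpr hxy]
        rw [ih hxs.2]
        constructor
        · rintro ⟨i, hi⟩; exact ⟨i + 1, by simpa using hi⟩
        · rintro ⟨i, hi, hi'⟩
          cases i with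
          | zero => simp at hi; exact absurd hi.symm hxy
          | succ i => exact ⟨i, by simpa using hi, by simpa using hi'⟩

variable {ι : Type}

theorem Ctx.ofLists_eq_some_iff {xs : List Var} {αs : List (Ty ι)} (h : xs.Nodup) {x : Var}
    {α : Ty ι} : Ctx.ofLists xs αs x = some α ↔ ∃ i : ℕ, xs[i]? = some x ∧ αs[i]? = some α :=
  List.lookup_zip_eq_some_iff h

theorem Ctx.extend_self (Γ : Ctx ι) (x : Var) (α : Ty ι) : Γ.extend x α x = some α := by
  simp [Ctx.extend]

theorem Ctx.extend_of_ne (Γ : Ctx ι) {x y : Var} (α : Ty ι) (h : y ≠ x) :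
    Γ.extend x α y = Γ y := by
  simp [Ctx.extend, h]

theorem Ctx.le_extend {Γ : Ctx ι} {x : Var} (hx : Γ x = none) (α : Ty ι) {y : Var} {β : Ty ι}
    (h : Γ y = some β) : Γ.extend x α y = some β := by
  rw [Ctx.extend_of_ne _ _ (by rintro rfl; simp [hx] at h), h]

theorem Ctx.extend_eq_some {Γ : Ctx ι} {x : Var} {α : Ty ι} {y : Var} {β : Ty ι}
    (h : Γ.extend x α y = some β) : y = x ∧ α = β ∨ y ≠ x ∧ Γ y = some β := by
  by_cases hy : y = x
  · subst hy; rw [Ctx.extend_self] at h; exact Or.inl ⟨rfl, by simpa using h⟩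
  · rw [Ctx.extend_of_ne _ _ hy] at h; exact Or.inr ⟨hy, h⟩

theorem Ctx.treeVars_mono {Γ Δ : Ctx ι} (h : ∀ y β, Γ y = some β → Δ y = some β) :
    Γ.treeVars ⊆ Δ.treeVars := by
  rintro y ⟨β, hβ, hn⟩
  exact ⟨β, h y β hβ, hn⟩

theorem Ctx.treeVars_subset_extend {Γ : Ctx ι} {x : Var} (hx : Γ x = none) (α : Ty ι) :
    Γ.treeVars ⊆ (Γ.extend x α).treeVars := Ctx.treeVars_mono fun _ _ => Ctx.le_extend hx α

theorem Ctx.mem_treeVars_extend {Γ : Ctx ι} {x y : Var} {α : Ty ι}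
    (h : y ∈ (Γ.extend x α).treeVars) :
    y = x ∧ α.numTrees = 1 ∨ y ≠ x ∧ y ∈ Γ.treeVars := by
  obtain ⟨β, hβ, hn⟩ := h
  rcases Ctx.extend_eq_some hβ with ⟨hy, rfl⟩ | ⟨hy, hβ⟩
  · exact Or.inl ⟨hy, hn⟩
  · exact Or.inr ⟨hy, β, hβ, hn⟩

theorem Ctx.self_mem_treeVars_extend (Γ : Ctx ι) (x : Var) {α : Ty ι} (h : α.numTrees = 1) :
    x ∈ (Γ.extend x α).treeVars := ⟨α, Ctx.extend_self Γ x α, h⟩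

theorem Ctx.left_le_join {Γ Δ : Ctx ι} {y : Var} {β : Ty ι} (h : Γ y = some β) :
    Γ.join Δ y = some β := by simp [Ctx.join, h]

theorem Ctx.right_le_join {Γ Δ : Ctx ι} (hd : Γ.Disjoint Δ) {y : Var} {β : Ty ι}
    (h : Δ y = some β) : Γ.join Δ y = some β := by
  rcases hd y with h' | h'
  · simp [Ctx.join, h, h']
  · simp [h] at h'

variable [BaseTypes ι]

theorem Ctx.Respects.mono {Γ Δ : Ctx ι} {σ : Var → Val ι} (hσ : Δ.Respects σ)
    (h : ∀ y β, Γ y = some β → Δ y = some β) : Γ.Respects σ :=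
  fun y β hy => hσ y β (h y β hy)

theorem Ctx.Respects.update {Γ : Ctx ι} {σ : Var → Val ι} (hσ : Γ.Respects σ) {x : Var} {v : Val ι}
    {α : Ty ι} (hv : v.HasType α) : (Γ.extend x α).Respects (Function.update σ x v) := by
  intro y β hy
  rcases Ctx.extend_eq_some hy with ⟨rfl, rfl⟩ | ⟨hne, hy⟩
  · simpa using hv
  · simpa [hne] using hσ y β hy

end Contexts

/-! ### Well-formedness of annotations and scoping in derivable judgements -/

section Regularity

variable {X Y : Type}

theorem Ann.For.mono {Q : Ann X} {s t : Set X} (hQ : Q.For s) (h : s ⊆ t) : Q.For t :=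
  ⟨fun x hx => h (hQ.1 x hx), fun i hi => ⟨fun x hx => h ((hQ.2 i hi).1 x hx), (hQ.2 i hi).2⟩⟩

theorem Finsupp.forall_support_add {A M : Type} [AddZeroClass M] {f g : A →₀ M} {p : A → Prop}
    (hf : ∀ x ∈ f.support, p x) (hg : ∀ x ∈ g.support, p x) : ∀ x ∈ (f + g).support, p x := by
  classical
  exact fun x hx => (Finset.mem_union.mp (Finsupp.support_add hx)).elim (hf x) (hg x)

theorem Finsupp.forall_support_single {A M : Type} [Zero M] {a : A} {b : M} {p : A → Prop}
    (h : b ≠ 0 → p a) : ∀ x ∈ (Finsupp.single a b).support, p x := by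
  classical
  intro x hx
  rw [Finsupp.mem_support_iff, Finsupp.single_apply] at hx
  split_ifs at hx with hax
  · exact hax ▸ h hx
  · exact absurd rfl hx

theorem Finsupp.forall_support_mapDomain {A B M : Type} [AddCommMonoid M] {f : A →₀ M} {g : A → B}
    {p : B → Prop} (hf : ∀ x ∈ f.support, p (g x)) : ∀ x ∈ (f.mapDomain g).support, p x := by
  classical
  intro x hx
  obtain ⟨y, hy, rfl⟩ := Finset.mem_image.mp (Finsupp.mapDomain_support hx)
  exact hf y hy

theorem Finsupp.forall_support_erase {A M : Type} [Zero M] [DecidableEq A] {f : A →₀ M} {a : A}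
    {p : A → Prop} (hf : ∀ x ∈ f.support, x ≠ a → p x) : ∀ x ∈ (f.erase a).support, p x := by
  intro x hx
  rw [Finsupp.support_erase, Finset.mem_erase] at hx
  exact hf x hx.2 hx.1

theorem Ann.For.add {Q R : Ann X} {s : Set X} (hQ : Q.For s) (hR : R.For s) : (Q + R).For s :=
  ⟨Finsupp.forall_support_add hQ.1 hR.1, Finsupp.forall_support_add hQ.2 hR.2⟩

theorem Ann.For.smul {Q : Ann X} {s : Set X} (hQ : Q.For s) (K : ℝ≥0) : (K • Q).For s :=
  ⟨fun x hx => hQ.1 x (Finsupp.support_smul hx), fun i hi => hQ.2 i (Finsupp.support_smul hi)⟩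

theorem Ann.For.zero (s : Set X) : (0 : Ann X).For s := by simp [Ann.For]

theorem Ann.For.const (K : ℝ≥0) (s : Set X) : (Ann.const K).For s :=
  ⟨by simp [Ann.const, Ann.rk], Finsupp.forall_support_single fun _ => by simp [idxSum_zero]⟩

theorem Ann.For.sum {κ : Type} {I : Finset κ} {A : κ → Ann X} {s : Set X}
    (h : ∀ k ∈ I, (A k).For s) : (∑ k ∈ I, A k).For s :=
  Finset.sum_induction A (fun Q => Q.For s) (fun _ _ => Ann.For.add) (Ann.For.zero s) h

theorem Ann.For.map {Q : Ann X} {s : Set X} (hQ : Q.For s) {g : X → Y} {t : Set Y}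
    (h : ∀ x ∈ s, g x ∈ t) : (Q.map g).For t := by
  refine ⟨Finsupp.forall_support_mapDomain fun x hx => h x (hQ.1 x hx),
    Finsupp.forall_support_mapDomain fun i hi => ⟨?_, ?_⟩⟩
  · exact Finsupp.forall_support_mapDomain fun x hx => h x ((hQ.2 i hi).1 x hx)
  · rw [idxSum_mapDomain]; exact (hQ.2 i hi).2

theorem Ann.For.atLeaf [DecidableEq X] {Q : Ann X} {s t : Set X} (hQ : Q.For s) {x : X}
    (h : ∀ y ∈ s, y ≠ x → y ∈ t) : (Q.atLeaf x).For t := by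
  refine Ann.For.add ⟨?_, Finsupp.forall_support_mapDomain fun i hi => ⟨?_, ?_⟩⟩
    (Ann.For.const _ _)
  · exact Finsupp.forall_support_erase fun y hy => h y (hQ.1 y hy)
  · exact Finsupp.forall_support_erase fun y hy => h y ((hQ.2 i hi).1 y hy)
  · have := (hQ.2 i hi).2
    rw [← idxSum_erase i.1 x] at this
    linarith

theorem Ann.For.atNode [DecidableEq X] {Q : Ann X} {s t : Set X} (hQ : Q.For s) {x y z : X}
    (h : ∀ u ∈ s, u ≠ x → u ∈ t) (hy : x ∈ s → y ∈ t) (hz : x ∈ s → z ∈ t) :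
    (Q.atNode x y z).For t := by
  have hx : Q.rk x ≠ 0 → x ∈ s := fun hq => hQ.1 x (Finsupp.mem_support_iff.mpr hq)
  refine ⟨?_, ?_⟩
  · refine Finsupp.forall_support_add (Finsupp.forall_support_add ?_ ?_) ?_
    · exact Finsupp.forall_support_erase fun u hu => h u (hQ.1 u hu)
    · exact Finsupp.forall_support_single fun hq => hy (hx hq)
    · exact Finsupp.forall_support_single fun hq => hz (hx hq)
  · refine Finsupp.forall_support_add (Finsupp.forall_support_add ?_ ?_) ?_
    · refine Finsupp.forall_support_mapDomain fun i hi => ⟨?_, ?_⟩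
      · have hx' : i.1 x ≠ 0 → x ∈ s := fun hq =>
          (hQ.2 i hi).1 x (Finsupp.mem_support_iff.mpr hq)
        refine Finsupp.forall_support_add (Finsupp.forall_support_add ?_ ?_) ?_
        · exact Finsupp.forall_support_erase fun u hu => h u ((hQ.2 i hi).1 u hu)
        · exact Finsupp.forall_support_single fun hq => hy (hx' hq)
        · exact Finsupp.forall_support_single fun hq => hz (hx' hq)
      · have := (hQ.2 i hi).2
        rw [← idxSum_erase i.1 x] at this
        simp only [idxSum_add, idxSum_single]
        linarith [Int.natCast_nonneg (i.1 x)]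
    · refine Finsupp.forall_support_single fun hq => ⟨?_, by simp [idxSum_single]⟩
      exact Finsupp.forall_support_single fun _ => hy (hx hq)
    · refine Finsupp.forall_support_single fun hq => ⟨?_, by simp [idxSum_single]⟩
      exact Finsupp.forall_support_single fun _ => hz (hx hq)

variable {ι : Type}

/-- The sum `∑ a + ∑ b + c - max (-e) 0` is at least one because `∑ a + c ≥ 1`, while `∑ b` is
non-negative and at least `-e`. -/
theorem CrossOK.crossTotal_for {Γ Δ : Ctx ι} (hd : Γ.Disjoint Δ) {k : CrossIdx} {A : Ann Var}
    {w : ℝ≥0} (hk : CrossOK Δ k A w) (hA : A.For Γ.treeVars) :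
    (crossTotal k A).For (Γ.join Δ).treeVars := by
  refine ⟨by simp [crossTotal, Ann.rk], Finsupp.forall_support_mapDomain fun i hi => ⟨?_, ?_⟩⟩
  · refine Finsupp.forall_support_add (fun x hx => ?_) (fun x hx => ?_)
    · exact Ctx.treeVars_mono (fun _ _ => Ctx.left_le_join) ((hA.2 i hi).1 x hx)
    · exact Ctx.treeVars_mono (fun _ _ => Ctx.right_le_join hd) (hk.2.1 x hx)
  · have h₁ := (hA.2 i hi).2
    have h₂ := hk.2.2.2.2.1
    have h₃ : 0 ≤ idxSum k.1 := Finset.sum_nonneg fun _ _ => by positivity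
    simp only [idxSum_add]
    omega

theorem FunType.WF.map_for {s : FunType ι} (h : s.WF) {xs : List Var} (hx : xs.Nodup)
    (hl : xs.length = s.args.length) :
    (s.dom.map fun i => xs.getD i 0).For (Ctx.ofLists xs s.args).treeVars := by
  refine h.1.map ?_
  rintro i ⟨α, hi, hα⟩
  refine ⟨α, (Ctx.ofLists_eq_some_iff hx).mpr ⟨i, ?_, hi⟩, hα⟩
  have : i < xs.length := hl ▸ (List.getElem?_eq_some_iff.mp hi).1
  simp [this]

variable [BaseTypes ι] {F : Type} {S : Signature ι F}

/-- Makes all potentials in a derivation non-negative, without which `ENNReal.ofReal` would not be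
additive on them. -/
theorem Typed.regular {m : Mode} {Γ : Ctx ι} {Q : Ann Var} {e : Expr ι F} {α : Ty ι}
    {Q' : Ann Unit} (h : Typed S m Γ Q e α Q') : Q.For Γ.treeVars ∧ Q'.For α.slot := by
  induction h with
  | var m x α Q' h =>
    exact ⟨h.map fun u hu => Ctx.self_mem_treeVars_extend _ x hu, h⟩
  | const m b a Q' h => exact ⟨h.map fun u hu => absurd hu (by simp [Ty.slot, Ty.numTrees]), h⟩
  | leaf m b Q' h =>
    exact ⟨(h.atLeaf (t := ∅) fun y _ hy => absurd rfl hy).map fun u hu => (by cases hu), h⟩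
  | node m b x₁ x₂ x₃ Q' hx h =>
    refine ⟨(h.map (t := {x₁}) fun u _ => rfl).atNode (fun u hu hu' => absurd hu hu')
      (fun _ => ?_) (fun _ => ?_), h⟩
    · exact ⟨_, (Ctx.ofLists_eq_some_iff hx).mpr ⟨0, rfl, rfl⟩, rfl⟩
    · exact ⟨_, (Ctx.ofLists_eq_some_iff hx).mpr ⟨2, rfl, rfl⟩, rfl⟩
  | cmp m op b x₁ x₂ Q' hx h => exact ⟨h.map fun u hu => absurd hu (by simp [Ty.slot, Ty.numTrees]), h⟩
  | pair m α₁ α₂ x₁ x₂ Q' hx hn h =>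
    refine ⟨h.map fun u hu => ?_, h⟩
    have hx' : [x₁, x₂].Nodup := by simpa using hx
    replace hu : α₁.numTrees + α₂.numTrees = 1 := hu
    split_ifs with hα
    · exact ⟨_, (Ctx.ofLists_eq_some_iff hx').mpr ⟨0, rfl, rfl⟩, hα⟩
    · exact ⟨_, (Ctx.ofLists_eq_some_iff hx').mpr ⟨1, rfl, rfl⟩, by omega⟩
  | ite m Γ x Q e₁ e₂ α Q' hx _ _ ih₁ _ =>
    exact ⟨ih₁.1.mono (Ctx.treeVars_subset_extend hx _), ih₁.2⟩
  | nondet m Γ Q e₁ e₂ α Q' _ _ ih₁ _ => exact ih₁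
  | coin m Γ p hp Q₁ Q₂ e₁ e₂ α Q' _ _ _ ih₁ ih₂ =>
    exact ⟨(ih₁.1.smul _).add (ih₂.1.smul _), ih₁.2⟩
  | coinNondet Γ p hp Q e₁ e₂ α Q' _ _ ih₁ _ => exact ih₁
  | tickNow m Γ Q c e α Q' _ ih => exact ⟨ih.1.add (.const _ _), ih.2⟩
  | matchTree m Γ b x y₁ y₂ y₃ Q e₁ e₂ α Q' _ _ _ _ _ hQ _ _ ih₁ _ => exact ⟨hQ, ih₁.2⟩
  | matchPair m Γ α₁ α₂ x y₁ y₂ Q e β Q' _ _ _ _ _ hQ _ ih => exact ⟨hQ, ih.2⟩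
  | letBase m Γ Δ x P D P' e₁ e₂ α β Q' hd _ _ hD _ _ _ ih₁ ih₂ =>
    exact ⟨(ih₁.1.mono (Ctx.treeVars_mono fun _ _ => Ctx.left_le_join)).add
      (hD.mono (Ctx.treeVars_mono fun _ _ => Ctx.right_le_join hd)), ih₂.2⟩
  | letTree m Γ Δ x P D P' I A w e₁ e₂ α β Q' hd _ _ hD _ _ hI _ _ ih₁ ihI ih₂ =>
    exact ⟨((ih₁.1.mono (Ctx.treeVars_mono fun _ _ => Ctx.left_le_join)).add
      (hD.mono (Ctx.treeVars_mono fun _ _ => Ctx.right_le_join hd))).add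
      (.sum fun k hk => (hI k hk).crossTotal_for hd (ihI k hk).1), ih₂.2⟩
  | app m f xs αs β P Q P' Q' K hx hl hP hQ _ _ =>
    refine ⟨?_, hP.2.add (hQ.2.smul K)⟩
    exact FunType.WF.map_for (s := ⟨αs, P + K • Q, β, P' + K • Q'⟩)
      ⟨hP.1.add (hQ.1.smul K), hP.2.add (hQ.2.smul K)⟩ hx hl
  | weakenVar m Γ x α Q e β Q' _ hQ _ ih => exact ⟨hQ, ih.2⟩
  | share m Γ x y z α Q e β Q' hx hy hz hxy _ _ ih =>
    refine ⟨ih.1.map fun v hv => ?_, ih.2⟩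
    rcases Ctx.mem_treeVars_extend hv with ⟨rfl, hα⟩ | ⟨hvy, hv⟩
    · simpa using Ctx.self_mem_treeVars_extend Γ z hα
    rcases Ctx.mem_treeVars_extend hv with ⟨rfl, hα⟩ | ⟨hvx, hv⟩
    · simpa using Ctx.self_mem_treeVars_extend Γ z hα
    · simpa [hvx, hvy] using Ctx.treeVars_subset_extend hz α hv
  | weaken m Γ P Q e α P' Q' hQ hQ' _ _ _ _ => exact ⟨hQ, hQ'⟩
  | shift m Γ Q e α Q' K _ ih => exact ⟨ih.1.add (.const _ _), ih.2.add (.const _ _)⟩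

/-- Lets the finite substitution made by a call be replaced by a total one, as in the statement of
soundness. -/
theorem Typed.fv_subset {m : Mode} {Γ : Ctx ι} {Q : Ann Var} {e : Expr ι F} {α : Ty ι}
    {Q' : Ann Unit} (h : Typed S m Γ Q e α Q') : ∀ x ∈ e.fv, Γ x ≠ none := by
  have hext : ∀ {Γ : Ctx ι} {x y : Var} {α : Ty ι},
      Γ.extend x α y ≠ none ↔ y = x ∨ Γ y ≠ none := by
    intro Γ x y α
    by_cases hy : y = x
    · subst hy; simp [Ctx.extend_self]
    · simp [Ctx.extend_of_ne _ _ hy, hy]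
  have hjoin : ∀ {Γ Δ : Ctx ι} {y : Var}, Γ.join Δ y ≠ none ↔ Γ y ≠ none ∨ Δ y ≠ none := by
    intro Γ Δ y
    simp only [Ctx.join, ne_eq, Option.or_eq_none_iff]
    tauto
  induction h with
  | var m x α Q' h => rintro y rfl; simp [Ctx.extend_self]
  | const => rintro y ⟨⟩
  | leaf => rintro y ⟨⟩
  | node m b x₁ x₂ x₃ Q' hx h =>
    simp only [Expr.fv, Opd.fv, Set.mem_union, Set.mem_singleton_iff, Ctx.ofLists]
    grind [List.lookup]
  | cmp m op b x₁ x₂ Q' hx h =>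
    simp only [Expr.fv, Opd.fv, Set.mem_union, Set.mem_singleton_iff, Ctx.ofLists]
    grind [List.lookup]
  | pair m α₁ α₂ x₁ x₂ Q' hx hn h =>
    simp only [Expr.fv, Opd.fv, Set.mem_union, Set.mem_singleton_iff, Ctx.ofLists]
    grind [List.lookup]
  | app m f xs αs β P Q P' Q' K hx hl _ _ _ _ =>
    rintro y ⟨o, ho, hy⟩
    obtain ⟨x, hxs, rfl⟩ := List.mem_map.mp ho
    cases hy
    obtain ⟨i, hi⟩ := List.mem_iff_getElem?.mp hxs
    have hi' : i < αs.length := hl ▸ (List.getElem?_eq_some_iff.mp hi).1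
    rw [(Ctx.ofLists_eq_some_iff hx).mpr ⟨i, hi, List.getElem?_eq_getElem hi'⟩]
    simp
  | share m Γ x y z α Q e β Q' hx hy hz hxy _ _ ih =>
    intro v hv
    obtain ⟨u, hu, rfl⟩ := Expr.fv_rename_subset e _ v hv
    have := ih u hu
    rw [hext, hext] at this
    rw [hext]
    split_ifs <;> tauto
  | _ =>
    simp only [Expr.fv, Opd.fv, Set.mem_union, Set.mem_sdiff, Set.mem_insert_iff,
      Set.mem_singleton_iff, hext, hjoin] at *
    grind

end Regularity

/-! ### Soundness of the type system -/

section Soundness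

variable {ι : Type} [BaseTypes ι] {F : Type} {P : Program ι F} {S : Signature ι F}

open Classical in
/-- The potential of a result; ill-typed results count as infinitely expensive. -/
def resultPotential (α : Ty ι) (Q' : Ann Unit) (v : Val ι) : ℝ≥0∞ :=
  if v.HasType α then ENNReal.ofReal (Q'.potential fun _ => v) else ⊤

theorem resultPotential_of_hasType {α : Ty ι} {v : Val ι} (h : v.HasType α) (Q' : Ann Unit) :
    resultPotential α Q' v = ENNReal.ofReal (Q'.potential fun _ => v) := by
  simp [resultPotential, h]

theorem resultPotential_of_not_hasType {α : Ty ι} {v : Val ι} (h : ¬ v.HasType α)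
    (Q' : Ann Unit) : resultPotential α Q' v = ⊤ := by
  simp [resultPotential, h]

/-- Payoffs only have to be compared at well-typed results, provided that the larger one is infinite
at all others. -/
theorem resultPotential_le {α : Ty ι} {Q' : Ann Unit} {B : Val ι → ℝ≥0∞}
    (h : ∀ v, v.HasType α → resultPotential α Q' v ≤ B v) (h' : ∀ v, ¬ v.HasType α → B v = ⊤)
    (v : Val ι) : resultPotential α Q' v ≤ B v := by
  by_cases hv : v.HasType α
  · exact h v hv
  · simp [h' v hv]

theorem worst_of_inst_toVal {m : Mode} {α : Ty ι} {Q' : Ann Unit} {n : ℕ} {e : Expr ι F}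
    {v : Val ι} {B : ℝ} (h : e.toVal = some v) (hv : v.HasType α)
    (hB : (Q'.potential fun _ => v) = B) :
    worst P m (resultPotential α Q') n e ≤ ENNReal.ofReal B := by
  rw [worst_of_toVal h, resultPotential_of_hasType hv, hB]

/-- A bound for expressions all of whose steps are deterministic and without cost. -/
theorem worst_le_of_steps {m : Mode} {g : Val ι → ℝ≥0∞} {n : ℕ} {e : Expr ι F} {B : ℝ≥0∞}
    (h₀ : e.toVal = none) (ht : ¬ Terminal P e)
    (h : ∀ k < n, ∀ c μ, Step P e c μ →
      c = 0 ∧ ∃ e', μ = {(1, e')} ∧ worst P m g k e' ≤ B) :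
    worst P m g n e ≤ B := by
  cases n with
  | zero => simp [worst_zero h₀]
  | succ k =>
    refine worst_succ_le ht fun c μ hs => ?_
    obtain ⟨rfl, e', rfl, he⟩ := h k k.lt_succ_self c μ hs
    rw [Mode.aggregate_singleton]
    cases m <;> simpa [Mode.stepCost] using he

theorem Step.app_inv {f : F} {args : List (Opd ι)} {c : ℝ≥0} {μ : MDist (Expr ι F)}
    (h : Step P (.app f args) c μ) : ∃ vs : List (Val ι), args = vs.map Opd.val ∧ c = 0 ∧
      μ = {(1, (P.body f).subst (bindings (P.params f) vs))} := by
  cases h with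
  | app _ vs _ => exact ⟨vs, rfl, rfl, rfl⟩

/-- The non-deterministic mode may be split off from every mode, one summand at a time. -/
theorem worst_add_sum_le {κ : Type} (m : Mode) (I : Finset κ) (H : κ → Val ι → ℝ≥0∞) (n : ℕ)
    (e : Expr ι F) : ∀ g : Val ι → ℝ≥0∞,
    worst P m (fun v => g v + ∑ k ∈ I, H k v) n e ≤
      worst P m g n e + ∑ k ∈ I, worst P .costFreeNondet (H k) n e := by
  classical
  induction I using Finset.induction_on with
  | empty => intro g; simp
  | insert k I hk ih =>
    intro g
    simp only [Finset.sum_insert hk]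
    have h := worst_add_le (P := P) (m := m) (m' := .costFreeNondet) (fun _ => rfl)
      (h := fun v => g v + (H k v + ∑ k ∈ I, H k v)) (g := fun v => g v + ∑ k ∈ I, H k v)
      (g' := H k) (K := 1) (fun v => by rw [one_mul, add_assoc, add_comm (H k v)]) n e
    refine h.trans ?_
    rw [one_mul, add_comm (worst P .costFreeNondet (H k) n e), ← add_assoc]
    gcongr
    exact ih g

/-- The common core of both let-rules. The payoff for `e₁` is all that the body needs: the potential
of the result, the mixed terms `H k`, each bounded in the non-deterministic mode by `T k`, and the
potential `D` of the other variables, which `e₁` leaves untouched. -/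
theorem worst_letIn_le_of_bounds {κ : Type} {m : Mode} {I : Finset κ} {H : κ → Val ι → ℝ≥0∞}
    {T : κ → ℝ} {g : Val ι → ℝ≥0∞} {α : Ty ι} {P' : Ann Unit} {x : Var} {e₁ e₂ : Expr ι F}
    {n : ℕ} {A D : ℝ} (hA : 0 ≤ A) (hT : ∀ k ∈ I, 0 ≤ T k) (hD : 0 ≤ D)
    (h₁ : worst P m (resultPotential α P') n e₁ ≤ ENNReal.ofReal A)
    (hI : ∀ k ∈ I, worst P .costFreeNondet (H k) n e₁ ≤ ENNReal.ofReal (T k))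
    (h₂ : ∀ k ≤ n, ∀ v, v.HasType α → worst P m g k (e₂.subst (bindings [x] [v])) ≤
      ENNReal.ofReal (P'.potential fun _ => v) + ∑ k ∈ I, H k v + ENNReal.ofReal D) :
    worst P m g n (.letIn x e₁ e₂) ≤ ENNReal.ofReal (A + ∑ k ∈ I, T k + D) := by
  have hs := Finset.sum_nonneg hT
  rw [ENNReal.ofReal_add (add_nonneg hA hs) hD, ENNReal.ofReal_add hA hs,
    ENNReal.ofReal_sum_of_nonneg hT]
  refine (worst_letIn_le (h := fun v => (resultPotential α P' v + ∑ k ∈ I, H k v)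
    + ENNReal.ofReal D) n e₁ fun k hk v => ?_).trans ?_
  · by_cases hv : v.HasType α
    · rw [resultPotential_of_hasType hv]; exact h₂ k hk v hv
    · simp [resultPotential_of_not_hasType hv]
  · refine (worst_add_const_le (fun v => le_rfl) n e₁).trans ?_
    gcongr
    refine (worst_add_sum_le m I H n e₁ _).trans ?_
    gcongr with k hk
    exact hI k hk

theorem Val.HasType.bool_inv {v : Val ι} (h : v.HasType Ty.bool) :
    ∃ b : Bool, v = .const .bool b := by
  cases h with
  | const _ b => exact ⟨b, rfl⟩

theorem Val.HasType.base_inv {v : Val ι} {b : Base ι} (h : v.HasType (.base b)) :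
    ∃ a : b.Elem, v = .const b a := by
  cases h with
  | const _ a => exact ⟨a, rfl⟩

theorem potential_letBody {Δ : Ctx ι} {D : Ann Var} (hD : D.For Δ.treeVars) {x : Var}
    (hx : Δ x = none) (P' : Ann Unit) (σ : Var → Val ι) (v : Val ι) :
    (D + P'.map fun _ => x).potential (Function.update σ x v) =
      D.potential σ + P'.potential fun _ => v := by
  rw [Ann.potential_add, Ann.potential_map]
  simp only [Function.update_self]
  rw [Ann.potential_congr_of_eqOn hD (τ := σ)]
  rintro y ⟨β, hy, -⟩
  have : y ≠ x := by rintro rfl; simp [hx] at hy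
  simp [this]

/-- The induction hypothesis `IH`, at the fuel left after the call, applied to the derivation that
the program provides for the body. The arguments are then read by position instead of by parameter
name. -/
theorem Program.WellTyped.worst_app_le (hP : P.WellTyped S) {n : ℕ}
    (IH : ∀ {m : Mode} {Γ : Ctx ι} {Q : Ann Var} {e : Expr ι F} {α : Ty ι} {Q' : Ann Unit},
      Typed S m Γ Q e α Q' → ∀ σ : Var → Val ι, Γ.Respects σ →
      worst P m (resultPotential α Q') n (e.inst σ) ≤ ENNReal.ofReal (Q.potential σ))
    {m : Mode} {f : F} {s : FunType ι} (hs : s ∈ S m f) {vs : List (Val ι)}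
    (hl : vs.length = s.args.length)
    (hvs : ∀ (i : ℕ) α v, s.args[i]? = some α → vs[i]? = some v → v.HasType α) :
    worst P m (resultPotential s.res s.cod) n ((P.body f).subst (bindings (P.params f) vs)) ≤
      ENNReal.ofReal (s.dom.potential fun i => vs.getD i .leaf) := by
  obtain ⟨hwf, hlen, ht⟩ := hP m f s hs
  have hnd := P.nodup f
  -- The default `leaf` is never used: all free variables of the body are parameters.
  set σ : Var → Val ι := fun x => (bindings (P.params f) vs x).getD .leaf with hσ
  have hb : ∀ {x : Var} {i : ℕ} {v : Val ι}, (P.params f)[i]? = some x → vs[i]? = some v →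
      bindings (P.params f) vs x = some v := fun hi hv =>
    (List.lookup_zip_eq_some_iff hnd).mpr ⟨_, hi, hv⟩
  have hget : ∀ {i : ℕ} {α : Ty ι}, s.args[i]? = some α → ∃ v, vs[i]? = some v := by
    intro i α hi
    have hi : i < vs.length := hl ▸ (List.getElem?_eq_some_iff.mp hi).1
    exact ⟨_, List.getElem?_eq_getElem hi⟩
  have hsub : (P.body f).subst (bindings (P.params f) vs) = (P.body f).inst σ := by
    refine Expr.subst_congr fun x hx => ?_
    obtain ⟨α, hα⟩ := Option.ne_none_iff_exists'.mp (ht.fv_subset x hx)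
    obtain ⟨i, hi, hi'⟩ := (Ctx.ofLists_eq_some_iff hnd).mp hα
    obtain ⟨v, hv⟩ := hget hi'
    simp [hσ, hb hi hv]
  have hres : (Ctx.ofLists (P.params f) s.args).Respects σ := by
    intro x α hα
    obtain ⟨i, hi, hi'⟩ := (Ctx.ofLists_eq_some_iff hnd).mp hα
    obtain ⟨v, hv⟩ := hget hi'
    simpa [hσ, hb hi hv] using hvs i α v hi' hv
  rw [hsub]
  refine (IH ht σ hres).trans_eq ?_
  rw [Ann.potential_map]
  congr 1
  refine Ann.potential_congr_of_eqOn hwf.1 ?_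
  rintro i ⟨α, hi, -⟩
  obtain ⟨v, hv⟩ := hget hi
  have hi' : i < (P.params f).length := hlen ▸ (List.getElem?_eq_some_iff.mp hi).1
  have := hb (List.getElem?_eq_getElem hi') hv
  simp [hσ, hi', this, hv]

/-- Soundness: the potential bounds the expected cost plus the expected potential of the result,
and evaluations do not get stuck. -/
theorem Program.WellTyped.worst_le (hP : P.WellTyped S) (n : ℕ) :
    ∀ {m : Mode} {Γ : Ctx ι} {Q : Ann Var} {e : Expr ι F} {α : Ty ι} {Q' : Ann Unit},
      Typed S m Γ Q e α Q' → ∀ σ : Var → Val ι, Γ.Respects σ →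
      worst P m (resultPotential α Q') n (e.inst σ) ≤ ENNReal.ofReal (Q.potential σ) := by
  -- `IH` covers whatever comes after an evaluation step. The inner induction covers what keeps the
  -- fuel: structural rules, the bound expression of a `let`, and its body in the extreme case of
  -- equal fuel.
  induction n using Nat.strong_induction_on with
  | _ n IH =>
  intro m Γ Q e α Q' h
  induction h with
  | var m x α Q' h =>
    intro σ hσ
    refine worst_of_inst_toVal (v := σ x) rfl (hσ x α (Ctx.extend_self _ x α)) ?_
    rw [Ann.potential_map]
  | const m b a Q' h =>
    intro σ hσ
    refine worst_of_inst_toVal (v := .const b a) rfl (.const b a) ?_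
    rw [Ann.potential_map]
    exact Ann.potential_congr h fun u hu => absurd hu (by simp [Ty.slot, Ty.numTrees])
  | leaf m b Q' h =>
    intro σ hσ
    refine worst_of_inst_toVal (v := .leaf) rfl (.leaf b) ?_
    rw [Ann.potential_map, Ann.potential_atLeaf]
    congr 1
  | node m b x₁ x₂ x₃ Q' hx h =>
    intro σ hσ
    have h₁ := hσ x₁ (.tree b) ((Ctx.ofLists_eq_some_iff hx).mpr ⟨0, rfl, rfl⟩)
    have h₂ := hσ x₂ (.base b) ((Ctx.ofLists_eq_some_iff hx).mpr ⟨1, rfl, rfl⟩)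
    have h₃ := hσ x₃ (.tree b) ((Ctx.ofLists_eq_some_iff hx).mpr ⟨2, rfl, rfl⟩)
    refine worst_of_inst_toVal (v := .node (σ x₁) (σ x₂) (σ x₃)) rfl (.node h₁ h₂ h₃) ?_
    -- The variable `x₁` stands both for the constructed tree and for its left subtree.
    rw [Ann.potential_atNode _ _ _ _ _ (σ x₂), Ann.potential_map]
    simp
  | cmp m op b x₁ x₂ Q' hx h =>
    intro σ hσ
    have hx' : [x₁, x₂].Nodup := by simpa using hx
    obtain ⟨a₁, h₁⟩ := (hσ x₁ (.base b) ((Ctx.ofLists_eq_some_iff hx').mpr ⟨0, rfl, rfl⟩)).base_inv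
    obtain ⟨a₂, h₂⟩ := (hσ x₂ (.base b) ((Ctx.ofLists_eq_some_iff hx').mpr ⟨1, rfl, rfl⟩)).base_inv
    change worst P m _ n (.cmp op (.val (σ x₁)) (.val (σ x₂))) ≤ _
    rw [h₁, h₂]
    refine worst_le_of_steps rfl (fun ht => ht _ _ (.cmp op b a₁ a₂)) fun k _ c μ hs => ?_
    cases hs with
    | cmp =>
      refine ⟨rfl, _, rfl, worst_of_inst_toVal rfl (.const _ _) ?_⟩
      rw [Ann.potential_map]
      exact Ann.potential_congr h fun u hu => absurd hu (by simp [Ty.slot, Ty.numTrees])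
  | pair m α₁ α₂ x₁ x₂ Q' hx hn h =>
    intro σ hσ
    have hx' : [x₁, x₂].Nodup := by simpa using hx
    have h₁ := hσ x₁ α₁ ((Ctx.ofLists_eq_some_iff hx').mpr ⟨0, rfl, rfl⟩)
    have h₂ := hσ x₂ α₂ ((Ctx.ofLists_eq_some_iff hx').mpr ⟨1, rfl, rfl⟩)
    refine worst_of_inst_toVal (v := .pair (σ x₁) (σ x₂)) rfl (.pair h₁ h₂) ?_
    rw [Ann.potential_map]
    refine Ann.potential_congr h fun u hu => ?_
    have := h₁.size_rank_pair h₂ hu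
    rw [apply_ite σ]
    exact ⟨this.1.symm, this.2.symm⟩
  | ite m Γ x Q e₁ e₂ α Q' hx t₁ t₂ _ _ =>
    intro σ hσ
    have hΓ : Γ.Respects σ := hσ.mono fun _ _ => Ctx.le_extend hx _
    obtain ⟨b, hb⟩ := (hσ x _ (Ctx.extend_self Γ x _)).bool_inv
    change worst P m _ n (.ite (.val (σ x)) (e₁.inst σ) (e₂.inst σ)) ≤ _
    rw [hb]
    cases b with
    | true =>
      refine worst_le_of_steps rfl (fun ht => ht _ _ (.iteTrue _ _)) fun k hk c μ hs => ?_
      cases hs with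
      | iteTrue => exact ⟨rfl, _, rfl, IH k hk t₁ σ hΓ⟩
    | false =>
      refine worst_le_of_steps rfl (fun ht => ht _ _ (.iteFalse _ _)) fun k hk c μ hs => ?_
      cases hs with
      | iteFalse => exact ⟨rfl, _, rfl, IH k hk t₂ σ hΓ⟩
  | nondet m Γ Q e₁ e₂ α Q' t₁ t₂ _ _ =>
    intro σ hσ
    change worst P m _ n (.nondet (e₁.inst σ) (e₂.inst σ)) ≤ _
    refine worst_le_of_steps rfl (fun ht => ht _ _ (.nondetLeft _ _)) fun k hk c μ hs => ?_
    cases hs with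
    | nondetLeft => exact ⟨rfl, _, rfl, IH k hk t₁ σ hσ⟩
    | nondetRight => exact ⟨rfl, _, rfl, IH k hk t₂ σ hσ⟩
  | coin m Γ p hp Q₁ Q₂ e₁ e₂ α Q' hm t₁ t₂ _ _ =>
    intro σ hσ
    change worst P m _ n (.coin p hp (e₁.inst σ) (e₂.inst σ)) ≤ _
    cases n with
    | zero => rw [worst_zero rfl]; exact zero_le
    | succ k =>
    refine worst_succ_le (fun ht => ht _ _ (.coin p hp _ _)) fun c μ hs => ?_
    cases hs with
    | coin =>
      have h₁ := IH k k.lt_succ_self t₁ σ hσ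
      have h₂ := IH k k.lt_succ_self t₂ σ hσ
      rw [Ann.potential_add, Ann.potential_smul, Ann.potential_smul]
      have n₁ := t₁.regular.1.potential_nonneg hσ.isTreeOn
      have n₂ := t₂.regular.1.potential_nonneg hσ.isTreeOn
      rw [ENNReal.ofReal_add (by positivity) (by positivity), ENNReal.ofReal_mul (by positivity),
        ENNReal.ofReal_mul (by positivity), ENNReal.ofReal_coe_nnreal, ENNReal.ofReal_coe_nnreal]
      have : ((p : ℝ≥0) : ℝ≥0∞) * worst P m (resultPotential α Q') k (e₁.inst σ) +
          ((1 - (p : ℝ≥0) : ℝ≥0) : ℝ≥0∞) * worst P m (resultPotential α Q') k (e₂.inst σ) ≤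
          (p : ℝ≥0) * ENNReal.ofReal (Q₁.potential σ) +
          ((1 - (p : ℝ≥0) : ℝ≥0) : ℝ≥0∞) * ENNReal.ofReal (Q₂.potential σ) := by
        gcongr
      cases m with
      | costed => simpa [Mode.stepCost, Mode.aggregate, MDist.expect] using this
      | costFree => simpa [Mode.stepCost, Mode.aggregate, MDist.expect] using this
      | costFreeNondet => exact absurd rfl hm
  | coinNondet Γ p hp Q e₁ e₂ α Q' t₁ t₂ _ _ =>
    intro σ hσ
    change worst P _ _ n (.coin p hp (e₁.inst σ) (e₂.inst σ)) ≤ _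
    cases n with
    | zero => rw [worst_zero rfl]; exact zero_le
    | succ k =>
    refine worst_succ_le (fun ht => ht _ _ (.coin p hp _ _)) fun c μ hs => ?_
    cases hs with
    | coin =>
      simp only [Mode.stepCost, Mode.aggregate, zero_add]
      refine iSup₂_le fun a ha => ?_
      simp only [Multiset.insert_eq_cons, Multiset.mem_cons, Multiset.mem_singleton] at ha
      rcases ha with rfl | rfl
      · exact IH k k.lt_succ_self t₁ σ hσ
      · exact IH k k.lt_succ_self t₂ σ hσ
  | tickNow m Γ Q c e α Q' t _ =>
    intro σ hσ
    change worst P _ _ n (.tick c (e.inst σ)) ≤ _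
    cases n with
    | zero => rw [worst_zero rfl]; exact zero_le
    | succ k =>
    refine worst_succ_le (fun ht => ht _ _ (.tick c _)) fun c' μ hs => ?_
    cases hs with
    | tick =>
      rw [Mode.aggregate_singleton, Ann.potential_add, Ann.potential_const,
        ENNReal.ofReal_add (t.regular.1.potential_nonneg hσ.isTreeOn) (by positivity),
        ENNReal.ofReal_coe_nnreal, add_comm]
      refine add_le_add (IH k k.lt_succ_self t σ hσ) ?_
      cases m <;> simp [Mode.stepCost, Mode.tickCost]
  | matchTree m Γ b x y₁ y₂ y₃ Q e₁ e₂ α Q' hx hy h₁ h₂ h₃ hQ t₁ t₂ _ _ =>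
    intro σ hσ
    have hΓ : Γ.Respects σ := hσ.mono fun _ _ => Ctx.le_extend hx _
    change worst P m _ n (.matchTree (.val (σ x)) (e₁.inst σ) y₁ y₂ y₃ _) ≤ _
    have hsx := hσ x _ (Ctx.extend_self Γ x _)
    generalize hv : σ x = v at hsx
    cases hsx with
    | leaf =>
      refine worst_le_of_steps rfl (fun ht => ht _ _ (.matchLeaf _ _ _ _ _)) fun k hk c μ hs => ?_
      cases hs with
      | matchLeaf =>
        refine ⟨rfl, _, rfl, (IH k hk t₁ σ hΓ).trans_eq ?_⟩
        rw [Ann.potential_atLeaf, ← hv, Function.update_eq_self]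
    | @node _ l d r hl hd hr =>
      refine worst_le_of_steps rfl (fun ht => ht _ _ (.matchNode _ _ _ _ _ _ _ _))
        fun k hk c μ hs => ?_
      cases hs with
      | matchNode =>
        have h12 : y₁ ≠ y₂ := by rintro rfl; simp at hy
        have h13 : y₁ ≠ y₃ := by rintro rfl; simp at hy
        have h23 : y₂ ≠ y₃ := by rintro rfl; simp at hy
        set σ' := Function.update (Function.update (Function.update σ y₁ l) y₂ d) y₃ r with hσ'
        refine ⟨rfl, _, rfl, ?_⟩
        rw [Expr.subst_bindings_eq_inst (σ := σ) (σ' := σ')]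
        · refine (IH k hk t₂ σ' (((hΓ.update hl).update hd).update hr)).trans_eq ?_
          rw [Ann.potential_atNode _ _ _ _ _ d]
          congr 1
          refine Ann.potential_congr_of_eqOn hQ fun u hu => ?_
          rcases Ctx.mem_treeVars_extend hu with ⟨rfl, -⟩ | ⟨hux, β, hu, -⟩
          · simp [hσ', h12, h13, hv]
          · have hu₁ : u ≠ y₁ := by rintro rfl; simp [hu] at h₁
            have hu₂ : u ≠ y₂ := by rintro rfl; simp [hu] at h₂
            have hu₃ : u ≠ y₃ := by rintro rfl; simp [hu] at h₃
            simp [hσ', hux, hu₁, hu₂, hu₃]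
        · have hb := fun {x v} => List.lookup_zip_eq_some_iff (x := x) (a := v) (as := [l, d, r]) hy
          rintro u (rfl | rfl | rfl)
          · exact hb.mpr ⟨0, rfl, by simp [hσ', h12, h13]⟩
          · exact hb.mpr ⟨1, rfl, by simp [hσ', h23]⟩
          · exact hb.mpr ⟨2, rfl, by simp [hσ']⟩
        · intro u hu
          simp only [not_or] at hu
          simp [hσ', hu]
  | matchPair m Γ α₁ α₂ x y₁ y₂ Q e β Q' hx hy h₁ h₂ hn hQ t _ =>
    intro σ hσ
    have hΓ : Γ.Respects σ := hσ.mono fun _ _ => Ctx.le_extend hx _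
    change worst P m _ n (.matchPair (.val (σ x)) y₁ y₂ _) ≤ _
    have hsx := hσ x _ (Ctx.extend_self Γ x _)
    generalize hv : σ x = v at hsx
    cases hsx with
    | @pair _ _ l r hl hr =>
      refine worst_le_of_steps rfl (fun ht => ht _ _ (.matchPair _ _ _ _ _)) fun k hk c μ hs => ?_
      cases hs with
      | matchPair =>
        set σ' := Function.update (Function.update σ y₁ l) y₂ r with hσ'
        refine ⟨rfl, _, rfl, ?_⟩
        rw [Expr.subst_bindings_eq_inst (σ := σ) (σ' := σ')]
        · refine (IH k hk t σ' ((hΓ.update hl).update hr)).trans_eq ?_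
          rw [Ann.potential_map]
          congr 1
          refine Ann.potential_congr hQ fun u hu => ?_
          rcases Ctx.mem_treeVars_extend hu with ⟨rfl, hα⟩ | ⟨hux, β, hu, -⟩
          · have := hl.size_rank_pair hr hα
            rw [hv, if_pos rfl, apply_ite σ']
            simpa [hσ', hy] using this
          · have hu₁ : u ≠ y₁ := by rintro rfl; simp [hu] at h₁
            have hu₂ : u ≠ y₂ := by rintro rfl; simp [hu] at h₂
            simp [hσ', hux, hu₁, hu₂]
        · have hb := fun {x v} => List.lookup_zip_eq_some_iff (x := x) (a := v) (as := [l, r])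
            (xs := [y₁, y₂]) (by simpa using hy)
          rintro u (rfl | rfl)
          · exact hb.mpr ⟨0, rfl, by simp [hσ', hy]⟩
          · exact hb.mpr ⟨1, rfl, by simp [hσ']⟩
        · intro u hu
          simp only [not_or] at hu
          simp [hσ', hu]
  | letBase m Γ Δ x P₁ D P' e₁ e₂ α β Q' hd hx hα hD _ t₁ t₂ ih₁ ih₂ =>
    intro σ hσ
    have hΓ : Γ.Respects σ := hσ.mono fun _ _ => Ctx.left_le_join
    have hΔ : Δ.Respects σ := hσ.mono fun _ _ => Ctx.right_le_join hd
    rw [Expr.inst_letIn, Ann.potential_add]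
    -- No mixed terms: the bound variable carries no potential.
    have := worst_letIn_le_of_bounds (κ := Empty) (P := P) (I := ∅) (T := fun _ => 0)
      (H := fun _ _ => 0) (g := resultPotential β Q') (x := x)
      (e₂ := e₂.subst fun y => if y = x then none else some (σ y))
      (t₁.regular.1.potential_nonneg hΓ.isTreeOn) (by simp)
      (hD.potential_nonneg hΔ.isTreeOn) (ih₁ σ hΓ) (by simp) fun k hk v hv => by
        rw [Expr.subst_bindings_eq_inst (σ := σ) (σ' := Function.update σ x v)
          (by rintro u rfl; simp [bindings]) (by intro u hu; simp [hu])]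
        have hr := hΔ.update (x := x) hv
        refine ((lt_or_eq_of_le hk).elim (fun hk => IH k hk t₂ _ hr)
          (fun hk => hk ▸ ih₂ _ hr)).trans ?_
        rw [potential_letBody hD hx, add_comm (D.potential σ)]
        simpa using ENNReal.ofReal_add_le
    simpa using this
  | letTree m Γ Δ x P₁ D P' I A w e₁ e₂ α β Q' hd hx hα hD _ t₁ hI tI t₂ ih₁ ihI ih₂ =>
    intro σ hσ
    have hΓ : Γ.Respects σ := hσ.mono fun _ _ => Ctx.left_le_join
    have hΔ : Δ.Respects σ := hσ.mono fun _ _ => Ctx.right_le_join hd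
    rw [Expr.inst_letIn, Ann.potential_add, Ann.potential_add, Ann.potential_sum, add_right_comm]
    refine worst_letIn_le_of_bounds
      (H := fun k v => ENNReal.ofReal ((crossBody x k (w k)).potential (Function.update σ x v)))
      (t₁.regular.1.potential_nonneg hΓ.isTreeOn)
      (fun k hk => ((hI k hk).crossTotal_for hd (tI k hk).regular.1).potential_nonneg hσ.isTreeOn)
      (hD.potential_nonneg hΔ.isTreeOn) (ih₁ σ hΓ) (fun k hk => ?_) fun k hk v hv => ?_
    -- The auxiliary judgement bounds its result potential at every value reached, and the finite
    -- bound also excludes ill-typed values. At each such value the bound is shifted to the mixed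
    -- term.
    · refine worst_nondet_le_of_imp ENNReal.ofReal_ne_top (fun v hv => ?_) n _ (ihI k hk σ hΓ)
      by_cases hvα : v.HasType α
      · rw [resultPotential_of_hasType hvα, ENNReal.ofReal_le_ofReal_iff
          ((tI k hk).regular.1.potential_nonneg hΓ.isTreeOn)] at hv
        exact ENNReal.ofReal_le_ofReal ((hI k hk).potential_le (tI k hk).regular.1 hΓ.isTreeOn
          hΔ.isTreeOn (hvα.size_rank.2 hα).1 hx hv)
      · rw [resultPotential_of_not_hasType hvα] at hv
        exact absurd (top_le_iff.mp hv) ENNReal.ofReal_ne_top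
    · rw [Expr.subst_bindings_eq_inst (σ := σ) (σ' := Function.update σ x v)
        (by rintro u rfl; simp [bindings]) (by intro u hu; simp [hu])]
      have hr := hΔ.update (x := x) hv
      refine ((lt_or_eq_of_le hk).elim (fun hk => IH k hk t₂ _ hr)
        (fun hk => hk ▸ ih₂ _ hr)).trans ?_
      rw [Ann.potential_add, potential_letBody hD hx, Ann.potential_sum,
        add_comm (D.potential σ), add_right_comm]
      refine ENNReal.ofReal_add_le.trans ?_
      gcongr
      refine ENNReal.ofReal_add_le.trans ?_
      gcongr
      exact Finset.le_sum_of_subadditive _ ENNReal.ofReal_zero.le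
        (fun _ _ => ENNReal.ofReal_add_le) _ _
  | app m f xs αs β P₁ Q P' Q' K hx hl hwP hwQ hfP hfQ =>
    intro σ hσ
    have he : (Expr.app (F := F) f (xs.map Opd.var)).inst σ =
        .app f ((xs.map σ).map Opd.val) := by
      simp [Expr.inst, Expr.subst, Opd.subst]
    rw [he]
    have hlen : (xs.map σ).length = αs.length := by simpa using hl
    have hvs : ∀ (i : ℕ) α v, αs[i]? = some α → (xs.map σ)[i]? = some v → v.HasType α := by
      intro i α v hi hv
      rw [List.getElem?_map, Option.map_eq_some_iff] at hv
      obtain ⟨y, hy, rfl⟩ := hv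
      exact hσ y α ((Ctx.ofLists_eq_some_iff hx).mpr ⟨i, hy, hi⟩)
    have hpar : (xs.map σ).length = (P.params f).length := hlen.trans (hP m f _ hfP).2.1
    refine worst_le_of_steps rfl (fun ht => ht _ _ (.app f _ hpar)) fun k hk c μ hs => ?_
    obtain ⟨vs, hvs', rfl, rfl⟩ := hs.app_inv
    have hinj : Function.Injective (Opd.val (ι := ι)) := fun _ _ h => by simpa using h
    rw [← hinj.list_map hvs']
    refine ⟨rfl, _, rfl, ?_⟩
    have hpot : ∀ R : Ann ℕ, FunType.WF ⟨αs, R, β, Q'⟩ →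
        (R.potential fun i => (xs.map σ).getD i .leaf) =
          (R.map fun i => xs.getD i 0).potential σ := by
      intro R hR
      rw [Ann.potential_map]
      refine Ann.potential_congr_of_eqOn hR.1 ?_
      rintro i ⟨α, hi, -⟩
      have : i < xs.length := hl ▸ (List.getElem?_eq_some_iff.mp hi).1
      simp [this]
    have b₁ := hP.worst_app_le (IH k hk) hfP hlen hvs
    have b₂ := hP.worst_app_le (IH k hk) hfQ hlen hvs
    rw [hpot _ ⟨hwP.1, hwQ.2⟩] at b₁
    rw [hpot _ hwQ] at b₂
    have n₁ := (hwP.map_for hx hl).potential_nonneg hσ.isTreeOn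
    have n₂ := (hwQ.map_for hx hl).potential_nonneg hσ.isTreeOn
    have hsum : ((P₁ + K • Q).map fun i => xs.getD i 0).potential σ =
        (P₁.map fun i => xs.getD i 0).potential σ +
          K * (Q.map fun i => xs.getD i 0).potential σ := by
      simp only [Ann.potential_map, Ann.potential_add, Ann.potential_smul]
    rw [hsum, ENNReal.ofReal_add n₁ (by positivity), ENNReal.ofReal_mul (by positivity),
      ENNReal.ofReal_coe_nnreal]
    -- The same body is bounded twice, by its type in mode `m` and by its cost-free one, and the
    -- second bound is added `K` times.
    refine (worst_add_le (m' := m.free) (g := resultPotential β P') (g' := resultPotential β Q')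
      (K := K) (by rintro rfl; rfl) (resultPotential_le (fun v hv => ?_) fun v hv => ?_) k _).trans ?_
    · simp only [resultPotential_of_hasType hv]
      rw [Ann.potential_add, Ann.potential_smul]
      refine ENNReal.ofReal_add_le.trans_eq ?_
      rw [ENNReal.ofReal_mul (by positivity), ENNReal.ofReal_coe_nnreal]
    · simp [resultPotential_of_not_hasType hv]
    · gcongr
  | weakenVar m Γ x α Q e β Q' hx hQ _ ih =>
    intro σ hσ
    exact (ih σ (hσ.mono fun _ _ => Ctx.le_extend hx _)).trans
      (ENNReal.ofReal_le_ofReal (hQ.potential_drop_le hσ.isTreeOn x))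
  | share m Γ x y z α Q e β Q' hx hy hz hxy hc _ ih =>
    intro σ hσ
    rw [Expr.inst_rename hc, Ann.potential_map]
    refine ih _ fun u γ hu => ?_
    rcases Ctx.extend_eq_some hu with ⟨rfl, rfl⟩ | ⟨huy, hu⟩
    · simpa using hσ z _ (Ctx.extend_self Γ z _)
    rcases Ctx.extend_eq_some hu with ⟨rfl, rfl⟩ | ⟨hux, hu⟩
    · simpa using hσ z _ (Ctx.extend_self Γ z _)
    · simpa [hux, huy] using hσ u γ (Ctx.le_extend hz _ hu)
  | weaken m Γ P₁ Q e α P' Q' hQ hQ' hle hle' _ ih =>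
    intro σ hσ
    refine (worst_mono (resultPotential_le (fun v hv => ?_) fun v hv => ?_) n _).trans
      ((ih σ hσ).trans (ENNReal.ofReal_le_ofReal (hle σ hσ)))
    · rw [resultPotential_of_hasType hv, resultPotential_of_hasType hv]
      exact ENNReal.ofReal_le_ofReal (hle' v hv)
    · exact resultPotential_of_not_hasType hv _
  | shift m Γ Q e α Q' K t ih =>
    intro σ hσ
    rw [Ann.potential_add, Ann.potential_const,
      ENNReal.ofReal_add (t.regular.1.potential_nonneg hσ.isTreeOn) (by positivity)]
    refine (worst_add_const_le (g := resultPotential α Q') (K := ENNReal.ofReal K)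
      (resultPotential_le (fun v hv => ?_) fun v hv => ?_) n _).trans ?_
    · rw [resultPotential_of_hasType hv, resultPotential_of_hasType hv, Ann.potential_add,
        Ann.potential_const]
      exact ENNReal.ofReal_add_le
    · simp [resultPotential_of_not_hasType hv]
    · gcongr
      exact ih σ hσ

end Soundness

/-! ### Counting the steps that are paid for by ticks -/

section StepCount

variable {ι : Type} [BaseTypes ι] {F : Type}

/-- An upper bound for the number of evaluation steps which are not accounted for by ticks: two
steps are allowed for every unit of cost. -/
def Expr.freeSteps : Expr ι F → ℕ
  | .ret _ => 0
  | .const _ _ => 0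
  | .leaf => 0
  | .node _ _ _ => 0
  | .pair _ _ => 0
  | .cmp _ _ _ => 1
  | .app _ _ => 1
  | .tick c e => if 1 ≤ c then e.freeSteps - 1 else e.freeSteps + 1
  | .ite _ e₁ e₂ => 1 + e₁.freeSteps + e₂.freeSteps
  | .nondet e₁ e₂ => 1 + e₁.freeSteps + e₂.freeSteps
  | .coin _ _ e₁ e₂ => 1 + e₁.freeSteps + e₂.freeSteps
  | .matchTree _ e₁ _ _ _ e₂ => 1 + e₁.freeSteps + e₂.freeSteps
  | .matchPair _ _ _ e => 1 + e.freeSteps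
  | .letIn _ e₁ e₂ => 1 + e₁.freeSteps + e₂.freeSteps

theorem Expr.freeSteps_subst (e : Expr ι F) : ∀ σ : Var → Option (Val ι),
    (e.subst σ).freeSteps = e.freeSteps := by
  induction e <;> intro σ <;> simp_all [Expr.subst, Expr.freeSteps]

/-- Directly below a tick an expression has one step of its own, and its branches contribute none.
The tick takes this one away, so a ticked function body has measure zero. -/
theorem Expr.Ticked.freeSteps_le {e : Expr ι F} : ∀ {t : Bool},
    e.Ticked t → e.freeSteps ≤ if t then 1 else 0 := by
  induction e with
  | tick c e ih =>
    intro t h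
    have := ih h.2
    simp only [if_true] at this
    simp [Expr.freeSteps, h.1, this]
  | matchPair o y₁ y₂ e ih =>
    rintro t ⟨rfl, h⟩
    simpa [Expr.freeSteps] using ih h
  | ite _ _ _ ih₁ ih₂ | nondet _ _ ih₁ ih₂ | coin _ _ _ _ ih₁ ih₂ | matchTree _ _ _ _ _ _ ih₁ ih₂
  | letIn _ _ _ ih₁ ih₂ =>
    rintro t ⟨rfl, h₁, h₂⟩
    have := ih₁ h₁
    have := ih₂ h₂
    simp_all [Expr.freeSteps]
  | cmp | app => rintro t rfl; simp [Expr.freeSteps]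
  | _ => intro t _; simp [Expr.freeSteps]

theorem MDist.expect_singleton {A : Type} (a : A) (h : A → ℝ≥0∞) :
    MDist.expect {(1, a)} h = h a := by simp [MDist.expect]

theorem MDist.expect_mapObj {A B : Type} (μ : MDist A) (k : A → B) (h : B → ℝ≥0∞) :
    (μ.mapObj k).expect h = μ.expect fun a => h (k a) := Mode.costed.aggregate_mapObj μ k h

/-- A step either uses up a unit of the measure or is a tick of cost at least one. The latter has
two units to spend: one for itself, one for the step below it that becomes visible. Calls bring in
bodies of measure zero. -/
theorem Step.freeSteps_le {P : Program ι F} (hT : P.Ticked) {e : Expr ι F} {c : ℝ≥0}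
    {μ : MDist (Expr ι F)} (h : Step P e c μ) :
    1 + μ.expect (fun e => (e.freeSteps : ℝ≥0∞)) ≤ e.freeSteps + 2 * (c : ℝ≥0∞) := by
  induction h with
  | letCtx x e₁ e₂ c μ hs ih =>
    rw [MDist.expect_mapObj]
    have : (fun e => ((Expr.letIn x e e₂).freeSteps : ℝ≥0∞)) =
        fun e => (e.freeSteps : ℝ≥0∞) + (1 + e₂.freeSteps : ℝ≥0∞) := by
      funext e; simp only [Expr.freeSteps]; push_cast; ring
    rw [this, MDist.expect_add, MDist.expect_const hs.mass]
    simp only [Expr.freeSteps]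
    push_cast
    calc _ = (1 + μ.expect fun e => (e.freeSteps : ℝ≥0∞)) + (1 + e₂.freeSteps) := by ring
      _ ≤ (e₁.freeSteps + 2 * (c : ℝ≥0∞)) + (1 + e₂.freeSteps) := by gcongr
      _ = _ := by ring
  | coin p hp e₁ e₂ =>
    have hμ := (Step.coin (P := P) p hp e₁ e₂).mass
    have h : MDist.expect {((p : ℝ≥0), e₁), (1 - (p : ℝ≥0), e₂)}
        (fun e => (e.freeSteps : ℝ≥0∞)) ≤ (e₁.freeSteps + e₂.freeSteps : ℝ≥0∞) := by
      refine (MDist.expect_le_iSup hμ _).trans (iSup₂_le fun a ha => ?_)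
      simp only [Multiset.insert_eq_cons, Multiset.mem_cons, Multiset.mem_singleton] at ha
      rcases ha with rfl | rfl
      · exact le_self_add
      · exact le_add_self
    simp only [Expr.freeSteps]
    push_cast
    rw [mul_zero, add_zero, add_assoc]
    gcongr
  | tick c e =>
    rw [MDist.expect_singleton]
    simp only [Expr.freeSteps]
    split_ifs with hc
    · have h₁ : (1 : ℝ≥0∞) ≤ ((c : ℝ≥0) : ℝ≥0∞) := by exact_mod_cast hc
      -- The subtraction in the measure of a tick is truncated, so only this inequality is
      -- available.
      have h₂ : (e.freeSteps : ℝ≥0∞) ≤ ((e.freeSteps - 1 : ℕ) : ℝ≥0∞) + 1 := by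
        exact_mod_cast (by omega : e.freeSteps ≤ e.freeSteps - 1 + 1)
      calc (1 + e.freeSteps : ℝ≥0∞) ≤ 1 + (((e.freeSteps - 1 : ℕ) : ℝ≥0∞) + 1) := by gcongr
        _ = ((e.freeSteps - 1 : ℕ) : ℝ≥0∞) + 2 * 1 := by ring
        _ ≤ _ := by gcongr
    · push_cast
      rw [add_comm (1 : ℝ≥0∞)]
      exact le_self_add
  | app f vs hl =>
    rw [MDist.expect_singleton, Expr.freeSteps_subst]
    have := (hT f).freeSteps_le
    simp_all [Expr.freeSteps]
  | letVal x w e₂ v hv =>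
    rw [MDist.expect_singleton, Expr.freeSteps_subst]
    simp only [Expr.freeSteps]
    push_cast
    rw [mul_zero, add_zero, add_right_comm]
    exact le_self_add
  | _ =>
    rw [MDist.expect_singleton]
    simp only [Expr.freeSteps, Expr.freeSteps_subst, ENNReal.coe_zero, mul_zero, add_zero]
    norm_cast <;> omega

end StepCount

/-! ### Cost, length and limit of evaluations -/

section Evaluations

variable {ι : Type} [BaseTypes ι] {F : Type} {P : Program ι F}

theorem MDist.expect_zero {A : Type} (h : A → ℝ≥0∞) : MDist.expect 0 h = 0 := rfl

theorem MDist.expect_cons {A : Type} (p : ℝ≥0) (a : A) (μ : MDist A) (h : A → ℝ≥0∞) :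
    MDist.expect ((p, a) ::ₘ μ) h = p * h a + μ.expect h := by simp [MDist.expect]

theorem MDist.expect_scale_add {A : Type} (p : ℝ≥0) (μ ν : MDist A) (h : A → ℝ≥0∞) :
    MDist.expect (μ.scale p + ν) h = p * μ.expect h + ν.expect h := by
  simp [MDist.expect, MDist.scale, Function.comp_def, mul_assoc, Multiset.sum_map_mul_left]

/-- Lifts a one-step inequality by linearity. It is used for the cost (`g = 0`, `A = 1`, `B = 0`)
and for the number of steps (`A = 0`, `B = 2`); the additive form avoids subtraction in `ℝ≥0∞`. -/
theorem MStep.expect_le {g f h : Expr ι F → ℝ≥0∞} {A B : ℝ≥0∞}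
    (hs : ∀ e c ν, StepNF P e c ν → g e + A * c + ν.expect h ≤ f e + B * c)
    {μ μ' : MDist (Expr ι F)} {c : ℝ≥0} (hμ : MStep P μ c μ') :
    μ.expect g + A * c + μ'.expect h ≤ μ.expect f + B * c := by
  induction hμ with
  | nil => simp [MDist.expect_zero]
  | cons p e c ν μ c' ν' he _ ih =>
    simp only [MDist.expect_cons, MDist.expect_scale_add, ENNReal.coe_add, ENNReal.coe_mul]
    calc _ = p * (g e + A * c + ν.expect h) + (μ.expect g + A * c' + ν'.expect h) := by ring
      _ ≤ p * (f e + B * c) + (μ.expect f + B * c') := add_le_add (mul_le_mul_right (hs e c ν he) _) ih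
      _ = _ := by ring

theorem MStep.le_expect {g h : Expr ι F → ℝ≥0∞} (hs : ∀ e c ν, StepNF P e c ν → g e ≤ ν.expect h)
    {μ μ' : MDist (Expr ι F)} {c : ℝ≥0} (hμ : MStep P μ c μ') : μ.expect g ≤ μ'.expect h := by
  induction hμ with
  | nil => simp [MDist.expect_zero]
  | cons p e c ν μ c' ν' he _ ih =>
    simp only [MDist.expect_cons, MDist.expect_scale_add]
    gcongr
    exact hs e c ν he

theorem StepNF.expect_one {e : Expr ι F} {c : ℝ≥0} {ν : MDist (Expr ι F)} (h : StepNF P e c ν) :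
    ν.expect (fun _ => 1) = 1 := by
  cases h with
  | nf _ => exact MDist.expect_singleton _ _
  | step _ _ hs => exact MDist.expect_const hs.mass 1

theorem MStep.expect_one {μ μ' : MDist (Expr ι F)} {c : ℝ≥0} (hμ : MStep P μ c μ') :
    μ'.expect (fun _ => 1) = μ.expect fun _ => 1 := by
  induction hμ with
  | nil => rfl
  | cons p e c ν μ c' ν' he _ ih =>
    rw [MDist.expect_cons, MDist.expect_scale_add, he.expect_one, ih]

/-- Normal forms are repeated: for values, `worst` ignores the fuel, and for stuck expressions it is
already infinite. -/
theorem StepNF.cost_add_expect_worst_le {g : Val ι → ℝ≥0∞} (n : ℕ) {e : Expr ι F} {c : ℝ≥0}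
    {ν : MDist (Expr ι F)} (h : StepNF P e c ν) :
    c + ν.expect (worst P .costed g n) ≤ worst P .costed g (n + 1) e := by
  cases h with
  | nf ht =>
    rw [MDist.expect_singleton, ENNReal.coe_zero, zero_add]
    cases hv : e.toVal with
    | some v => rw [worst_of_toVal hv, worst_of_toVal hv]
    | none => rw [worst_stuck hv ht]; exact le_top
  | step _ _ hs => exact hs.le_worst

variable {e : Expr ι F} (E : Evaluation P e)

/-- Telescoping: each step moves one unit of fuel from `worst` into cost already incurred. The
residual fuel `k` is kept general for the induction and for detecting stuck members later. -/
theorem Evaluation.sum_cost_le (g : Val ι → ℝ≥0∞) (n : ℕ) : ∀ k,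
    ∑ i ∈ Finset.range n, (E.stepCost i : ℝ≥0∞) + (E.state n).expect (worst P .costed g k) ≤
      worst P .costed g (n + k) e := by
  induction n with
  | zero => intro k; simp [E.init, MDist.expect_singleton]
  | succ n ih =>
    intro k
    rw [Finset.sum_range_succ, add_assoc]
    have h := (E.step n).expect_le (g := 0) (A := 1) (B := 0) (h := worst P .costed g k)
      (f := worst P .costed g (k + 1)) fun e c ν h => by
        simpa using h.cost_add_expect_worst_le k
    have h₀ : (E.state n).expect 0 = 0 := by simp [MDist.expect]
    rw [h₀, zero_add, one_mul, zero_mul, add_zero] at h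
    refine (add_le_add_right h _).trans ((ih (k + 1)).trans_eq ?_)
    rw [show n + (k + 1) = n + 1 + k by ring]

theorem Evaluation.cost_le {g : Val ι → ℝ≥0∞} {B : ℝ≥0∞}
    (h : ∀ n, worst P .costed g n e ≤ B) : E.cost ≤ B := by
  rw [Evaluation.cost, ENNReal.tsum_eq_iSup_nat]
  exact iSup_le fun n => le_self_add.trans ((E.sum_cost_le g n 0).trans (h _))

open Classical in
theorem MDist.coe_activeProb (μ : MDist (Expr ι F)) :
    (μ.activeProb P : ℝ≥0∞) = μ.expect fun e => if Terminal P e then 0 else 1 := by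
  rw [MDist.activeProb, MDist.expect]
  refine (map_multiset_sum ENNReal.ofNNRealHom _).trans ?_
  rw [Multiset.map_map]
  congr 2
  funext a
  simp only [Function.comp]
  split_ifs <;> simp
  rfl

open Classical in
theorem MDist.coe_valueProb (μ : MDist (Expr ι F)) (v : Val ι) :
    (μ.valueProb v : ℝ≥0∞) = μ.expect fun e => if e.toVal = some v then 1 else 0 := by
  rw [MDist.valueProb, MDist.expect]
  refine (map_multiset_sum ENNReal.ofNNRealHom _).trans ?_
  rw [Multiset.map_map]
  congr 2
  funext a
  simp only [Function.comp]
  split_ifs <;> simp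
  rfl

theorem Evaluation.sum_activeProb_le (hT : P.Ticked) (n : ℕ) :
    ∑ i ∈ Finset.range n, ((E.state i).activeProb P : ℝ≥0∞) +
      (E.state n).expect (fun e => (e.freeSteps : ℝ≥0∞)) ≤
      e.freeSteps + 2 * ∑ i ∈ Finset.range n, (E.stepCost i : ℝ≥0∞) := by
  classical
  induction n with
  | zero => simp [E.init, MDist.expect_singleton]
  | succ n ih =>
    rw [Finset.sum_range_succ, Finset.sum_range_succ, mul_add, add_assoc, MDist.coe_activeProb]
    have h := (E.step n).expect_le (g := fun e => if Terminal P e then 0 else 1) (A := 0) (B := 2)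
      (h := fun e => (e.freeSteps : ℝ≥0∞)) (f := fun e => (e.freeSteps : ℝ≥0∞))
      fun e c ν h => by
        cases h with
        | nf ht => simp [ht, MDist.expect_singleton]
        | step _ _ hs =>
          have : ¬ Terminal P e := fun ht => ht _ _ hs
          simpa [this] using hs.freeSteps_le hT
    rw [zero_mul, add_zero] at h
    calc _ ≤ _ := add_le_add_right h _
      _ = (∑ i ∈ Finset.range n, ((E.state i).activeProb P : ℝ≥0∞) +
          (E.state n).expect fun e => (e.freeSteps : ℝ≥0∞)) + 2 * (E.stepCost n : ℝ≥0∞) := by ring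
      _ ≤ _ := by rw [← add_assoc]; gcongr

theorem Evaluation.length_le (hT : P.Ticked) : E.length ≤ e.freeSteps + 2 * E.cost := by
  rw [Evaluation.length, ENNReal.tsum_eq_iSup_nat]
  refine iSup_le fun n => le_self_add.trans ((E.sum_activeProb_le hT n).trans ?_)
  gcongr
  exact ENNReal.sum_le_tsum _

theorem Evaluation.expect_one (n : ℕ) : (E.state n).expect (fun _ => 1) = 1 := by
  induction n with
  | zero => rw [E.init, MDist.expect_singleton]
  | succ n ih => rw [(E.step n).expect_one, ih]

theorem MDist.tsum_valueProb (μ : MDist (Expr ι F)) :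
    ∑' v, (μ.valueProb v : ℝ≥0∞) = μ.expect fun e => e.toVal.elim 0 fun _ => 1 := by
  classical
  simp only [MDist.coe_valueProb]
  induction μ using Multiset.induction_on with
  | empty => simp [MDist.expect_zero]
  | cons a μ ih =>
    obtain ⟨p, e⟩ := a
    simp only [MDist.expect_cons, ENNReal.tsum_add, ih, ENNReal.tsum_mul_left]
    cases h : e.toVal <;> simp

theorem Evaluation.valueProb_mono (v : Val ι) :
    Monotone fun n => ((E.state n).valueProb v : ℝ≥0∞) := by
  classical
  refine monotone_nat_of_le_succ fun n => ?_
  rw [MDist.coe_valueProb, MDist.coe_valueProb]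
  refine (E.step n).le_expect fun e c ν h => ?_
  cases h with
  | nf _ => rw [MDist.expect_singleton]
  | step _ _ hs => simp [hs.toVal_eq_none]

/-- By monotonicity in time, finite sums commute with the suprema, and at each time the values have
total mass at most one. -/
theorem Evaluation.tsum_limit_le_one : ∑' v, E.limit v ≤ 1 := by
  rw [ENNReal.tsum_eq_iSup_sum]
  refine iSup_le fun s => ?_
  simp only [Evaluation.limit]
  rw [ENNReal.finsetSum_iSup_of_monotone fun v => E.valueProb_mono v]
  refine iSup_le fun n => (ENNReal.sum_le_tsum s).trans ?_
  rw [MDist.tsum_valueProb]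
  refine le_trans ?_ (E.expect_one n).le
  refine Multiset.sum_map_le_sum_map _ _ fun a _ => ?_
  cases hv : a.2.toVal <;> simp [hv]

/-- Every member is a value, reducible or stuck. A stuck one of positive weight would make the
expectation of `worst` infinite, against `h`, so the first two kinds carry the whole mass. -/
theorem Evaluation.one_le_tsum_limit_add {g : Val ι → ℝ≥0∞} (n : ℕ)
    (h : worst P .costed g (n + 1) e ≠ ⊤) :
    1 ≤ ∑' v, E.limit v + ((E.state n).activeProb P : ℝ≥0∞) := by
  classical
  -- With fuel zero `worst` does not notice that an expression is stuck; fuel one is enough.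
  have hle : (E.state n).expect (worst P .costed g 1) ≤ worst P .costed g (n + 1) e :=
    le_add_self.trans (E.sum_cost_le g n 1)
  have hlim : ∑' v, ((E.state n).valueProb v : ℝ≥0∞) ≤ ∑' v, E.limit v :=
    ENNReal.tsum_le_tsum fun v => le_iSup (fun n => ((E.state n).valueProb v : ℝ≥0∞)) n
  refine le_trans ?_ (add_le_add_left hlim _)
  rw [MDist.tsum_valueProb, MDist.coe_activeProb, ← MDist.expect_add]
  refine (E.expect_one n).ge.trans ?_
  refine Multiset.sum_map_le_sum_map _ _ fun a ha => ?_
  cases hv : a.2.toVal with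
  | some v => simp [hv, mul_add]
  | none =>
    by_cases ht : Terminal P a.2
    · have hmem : (a.1 : ℝ≥0∞) * worst P .costed g 1 a.2 ≤
          (E.state n).expect (worst P .costed g 1) :=
        Multiset.single_le_sum (fun _ _ => zero_le) _
          (Multiset.mem_map_of_mem (fun a : ℝ≥0 × Expr ι F => (a.1 : ℝ≥0∞) * worst P .costed g 1 a.2)
            ha)
      rw [worst_stuck hv ht] at hmem
      have : (a.1 : ℝ≥0∞) = 0 := by
        by_contra h0
        rw [ENNReal.mul_top h0] at hmem
        exact h (top_le_iff.mp (hmem.trans hle))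
      simp [this]
    · simp [ht, mul_add]

/-- The length is the sum of the probabilities of reducible expressions; being finite, it makes them
tend to zero. -/
theorem Evaluation.tsum_limit_eq_one {g : Val ι → ℝ≥0∞}
    (h : ∀ n, worst P .costed g n e ≠ ⊤) (hl : E.length ≠ ⊤) : ∑' v, E.limit v = 1 := by
  refine le_antisymm E.tsum_limit_le_one ?_
  have ht := ENNReal.tendsto_atTop_zero_of_tsum_ne_top hl
  have := (tendsto_const_nhds (x := ∑' v, E.limit v)).add ht
  rw [add_zero] at this
  exact ge_of_tendsto' this fun n => E.one_le_tsum_limit_add n (h (n + 1))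

end Evaluations

end

theorem corollary1 {ι : Type} [BaseTypes ι] {F : Type} (P : Program ι F) (S : Signature ι F)
    (hP : P.WellTyped S) (hT : P.Ticked) (Γ : Ctx ι) (Q : Ann Var) (e : Expr ι F) (α : Ty ι)
    (Q' : Ann Unit) (he : Typed S .costed Γ Q e α Q') :
    PositivelyAlmostSurelyTerminating P Γ e ∧ AlmostSurelyTerminating P Γ e := by
  have hle := fun σ hσ n => hP.worst_le n he σ hσ
  have hpast : PositivelyAlmostSurelyTerminating P Γ e := fun σ hσ E => by
    have hc : E.cost < ⊤ := (E.cost_le (hle σ hσ)).trans_lt ENNReal.ofReal_lt_top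
    exact ⟨hc, (E.length_le hT).trans_lt (ENNReal.add_lt_top.mpr ⟨ENNReal.natCast_lt_top _,
      ENNReal.mul_lt_top ENNReal.ofNat_lt_top hc⟩)⟩
  exact ⟨hpast, fun σ hσ E => E.tsum_limit_eq_one
    (fun n => ((hle σ hσ n).trans_lt ENNReal.ofReal_lt_top).ne) (hpast σ hσ E).2.ne⟩
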